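/- **Setting.** Let $F$ be a CNF formula with finite variable set $V$, that is, a finite set of clauses, each a finite set of literals $v$, $\neg v$ ($v\in V$); let $\mathrm{Lit}(F)$ be the set of all these literals. A *symmetry* of $F$ is a permutation of $\mathrm{Lit}(F)$ that commutes with negation and maps the set of clauses to itself; $\mathrm{Aut}(F)$ is the group of symmetries. The *model graph* $G(F)=(G,\pi)$ has as vertices the literals (color $0$) and the clauses (color $1$); each literal is adjacent to its negation and to the clauses containing it. For a vertex-colored graph $(G,\pi)$, $\mathrm{IR}((G,\pi),v)$ is the coloring obtained by giving $v$ a new color of its own and then running color refinement (repeatedly recoloring each vertex by its color and the multiset of colors of its neighbors) until the color partition is stable; $\mathrm{IR}((G,\pi),\epsilon)$ is color refinement alone. $(G,\pi)$ is *Tinhofer* if for every vertex $v$ the orbits of the stabilizer $\mathrm{Aut}(G,\pi)_v$ are exactly the color classes of $\pi'=\mathrm{IR}((G,\pi),v)$, and the same holds recursively for $(G,\pi')$. A *disjoint direct decomposition* of $F$ is a partition of $\mathrm{Lit}(F)$ into parts $L_1,\dots,L_k$ such that $\mathrm{Aut}(F)=A_1\times\dots\times A_k$ for subgroups $A_i$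 where $A_i$ only moves literals in $L_i$; the parts of the finest one are the *disjoint direct factors*. Write $[n]=\{1,\dots,n\}$; $\mathcal J_n$ is $\mathrm{Sym}(n)$ acting on $\binom{[n]}{2}$. $F$ *exhibits a Johnson symmetry $\mathcal J_n$ on $\sigma\subseteq\mathrm{Lit}(F)$ via $b$* if $\sigma$ is an orbit of $\mathrm{Aut}(F)$, $\sigma\cup\neg\sigma$ is a disjoint direct factor, $b\colon\sigma\to\binom{[n]}{2}$ is a bijection, and the permutation group that $\mathrm{Aut}(F)$ induces on $\sigma$ corresponds under $b$ to $\mathcal J_n$. For a permutation $\varphi$ of $\mathrm{Lit}(F)$, $\mathrm{expand}_F(\varphi)$ maps $l$ to $\varphi(l)$ if $\varphi(l)\ne l$, otherwise to $\neg\varphi(\neg l)$ if $\varphi(\neg l)\neq\neg l$, and otherwise to $l$. For a bijection $b:\sigma\to\binom{[n]}2$ and $\tau\in\mathrm{Sym}(n)$, the permutation of $\sigma$ *induced by $\tau$ via $b$* maps the literal with label set $\{i,j\}$ to the one with label set $\{\tau(i),\tau(j)\}$ (and all literals outside $\sigma$ are fixed). **Algorithm DetectJohnson**, on input $F$ and $\sigma\subseteq\mathrm{Lit}(F)$.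 All choices are arbitrary; a failing check returns $\bot$. The fragments of $\sigma$ in a coloring are the nonempty intersections of $\sigma$ with color classes. 1. Let $(G,\pi)=G(F)$, $\pi'=\mathrm{IR}((G,\pi),\epsilon)$. Check that $|\sigma|\ge 28$ and $|\sigma|=\binom n2$ for some $n$. Set $\mathrm{label}[v]=[\,]$ and $\mathrm{ad}[v]=\emptyset$ for all $v$, and $\mathrm{vnr}=1$. 2. While some $v\in\sigma$ has $|\mathrm{label}[v]|\le1$: - Choose such a $v$. *Explore* $v$: check that $\sigma$ has exactly $3$ fragments in $\pi_v=\mathrm{IR}((G,\pi'),v)$, and add to $\mathrm{ad}[v]$ the elements of the smaller non-singleton fragment. - Choose $w\in\mathrm{ad}[v]$ and explore $w$ in the same way. Let $\{y\}$ be the unique singleton fragment of $\sigma$ in $\mathrm{IR}((G,\pi_v),w)$ other than $\{v\},\{w\}$ (return $\bot$ if there is no unique one), and explore $y$. - Put $E_i=\{v,y\}\cup((\mathrm{ad}[v]\cap\mathrm{ad}[y])\setminus\{w\})$, $E_j=\{v,w\}\cup((\mathrm{ad}[v]\cap\mathrm{ad}[w])\setminus\{y\})$, $E_k=\{w,y\}\cup((\mathrm{ad}[w]\cap\mathrm{ad}[y])\setminus\{v\})$.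 For $E=E_i,E_j,E_k$ in turn: if the lists $\mathrm{label}[x]$, $x\in E$, have no common entry, append $\mathrm{vnr}$ to $\mathrm{label}[x]$ for all $x\in E$ and increase $\mathrm{vnr}$ by $1$. Check that some label was added in this iteration. 3. Check that $\mathrm{label}$ induces a bijection $\sigma\to\binom{[n]}2$ and that for each $i\in[n-1]$, $\mathrm{expand}_F(\beta)$ is a symmetry of $F$, where $\beta$ is the permutation of $\sigma$ induced by the transposition $(i,i+1)$ via $\mathrm{label}$. Return $\mathrm{label}$. **Theorem.** Let $F$ be a CNF formula and $\sigma\subseteq\mathrm{Lit}(F)$. For all choices made in the algorithm: 1. Suppose $\sigma\cap\neg\sigma=\emptyset$. If DetectJohnson returns $\mathrm{label}$, then, for the $n$ with $|\sigma|=\binom n2$, $\mathrm{label}$ is a bijective labeling of $\sigma$ by the $2$-subsets of $[n]$, and for every $\tau\in\mathrm{Sym}(n)$ the map $\mathrm{expand}_F(\beta)$ is a symmetry of $F$, where $\beta$ is the permutation of $\sigma$ induced by $\tau$ via $\mathrm{label}$. 2. Suppose $F$ exhibits a Johnson symmetry $\mathcal J_n$ with $n\ge8$ on $\sigma$ via $b$,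 and $G(F)$ is Tinhofer. Then DetectJohnson terminates and returns a labeling $\mathrm{label}$ for which there is $\tau\in\mathrm{Sym}(n)$ such that for all $v\in\sigma$ with $b(v)=\{i,j\}$, the entries of $\mathrm{label}[v]$ form the set $\{\tau(i),\tau(j)\}$. -/

import Mathlib

namespace JohnsonSym

open scoped Classical

universe u

noncomputable section

/-! ### CNF formulas and their symmetries -/

/-- A literal over the variable set `V`: `(v, true)` is `v` and `(v, false)` is `¬ v`. -/
abbrev Lit (V : Type u) : Type u := V × Bool

/-- The negation of a literal. -/
def neg {V : Type u} (l : Lit V) : Lit V := (l.1, !l.2)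

/-- A CNF formula with variable set `V`: a finite set of clauses, each a finite set of literals. -/
abbrev Formula (V : Type u) : Type u := Finset (Finset (Lit V))

/-- The map `f` on literals is a symmetry of `F`: it is a permutation of the literals that
commutes with negation and maps the set of clauses to itself. -/
def IsSymmetry {V : Type u} (F : Formula V) (f : Lit V → Lit V) : Prop :=
  Function.Bijective f ∧ (∀ l, f (neg l) = neg (f l)) ∧ F.image (fun C => C.image f) = F

/-- The group `Aut(F)` of symmetries of `F`. -/
def Aut {V : Type u} (F : Formula V) : Subgroup (Equiv.Perm (Lit V)) where
  carrier := {g | IsSymmetry F g}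
  one_mem' := by
    refine ⟨Function.bijective_id, fun _ => rfl, ?_⟩
    simp
  mul_mem' := by
    rintro g h ⟨_, hg, hgF⟩ ⟨_, hh, hhF⟩
    refine ⟨(g * h).bijective, fun l => by simp [hg, hh], ?_⟩
    conv_rhs => rw [← hgF, ← hhF]
    rw [Finset.image_image]
    congr 1
    funext C
    simp [Finset.image_image, Equiv.Perm.coe_mul]
  inv_mem' := by
    rintro g ⟨_, hg, hgF⟩
    refine ⟨(g⁻¹).bijective, fun l => ?_, ?_⟩
    · apply g.injective
      simp [hg]
    · conv_lhs => rw [← hgF]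
      rw [Finset.image_image]
      have : ((fun C : Finset (Lit V) => C.image (g⁻¹ : Equiv.Perm (Lit V))) ∘
          fun C : Finset (Lit V) => C.image g) = id := by
        funext C
        have h : (⇑g⁻¹ ∘ ⇑g) = id := funext fun x => by simp
        simp only [Function.comp_apply, Finset.image_image, h, Finset.image_id, id]
      rw [this, Finset.image_id]

/-! ### Individualization-refinement on vertex-colored graphs -/

/-- The automorphism group `Aut(G, π)` of a vertex-colored graph. -/
def colorAut {U : Type u} (G : SimpleGraph U) (π : U → ℕ) : Subgroup (Equiv.Perm U) where
  carrier := {g | (∀ x y, G.Adj (g x) (g y) ↔ G.Adj x y) ∧ ∀ x, π (g x) = π x}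
  one_mem' := ⟨fun _ _ => Iff.rfl, fun _ => rfl⟩
  mul_mem' := by
    rintro g h ⟨hg, hg'⟩ ⟨hh, hh'⟩
    exact ⟨fun x y => by simp [hg, hh], fun x => by simp [hg', hh']⟩
  inv_mem' := by
    rintro g ⟨hg, hg'⟩
    exact ⟨fun x y => by simpa using (hg (g⁻¹ x) (g⁻¹ y)).symm,
      fun x => by simpa using (hg' (g⁻¹ x)).symm⟩

/-- The former color of `x` together with the multiset of colors of its neighbors
(encoded as a sorted list). -/
def signature {U : Type u} [Fintype U] (G : SimpleGraph U) (π : U → ℕ) (x : U) : ℕ ×ₗ List ℕ :=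
  toLex (π x, (((Finset.univ.filter fun y => G.Adj x y).val.map π).sort (· ≤ ·)))

/-- One round of color refinement: every vertex is recolored according to its signature, the
new colors being the ranks of the signatures that occur (so two vertices get the same new color
exactly if they have the same signature). -/
def refineStep {U : Type u} [Fintype U] (G : SimpleGraph U) (π : U → ℕ) (x : U) : ℕ :=
  ((Finset.univ.image (signature G π)).filter fun t => t < signature G π x).card

/-- Color refinement, i.e. `IR((G, π), ε)`. The number of colors grows in every round until the
color partition is stable, so that it is stable after `|U|` rounds. -/
def colorRefine {U : Type u} [Fintype U] (G : SimpleGraph U) (π : U → ℕ) : U → ℕ :=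
  (refineStep G)^[Fintype.card U] π

/-- The vertex `v` obtains a new color, distinct from all others. -/
def individualize {U : Type u} (π : U → ℕ) (v : U) : U → ℕ :=
  fun x => if x = v then 0 else π x + 1

/-- `IR((G, π), v)`: individualize `v`, then run color refinement. -/
def IR {U : Type u} [Fintype U] (G : SimpleGraph U) (π : U → ℕ) (v : U) : U → ℕ :=
  colorRefine G (individualize π v)

/-- For every vertex `v`, the orbits of the stabilizer `Aut(G, π)_v` are exactly the color
classes of `IR((G, π), v)`. -/
def OrbitsAreColors {U : Type u} [Fintype U] (G : SimpleGraph U) (π : U → ℕ) : Prop :=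
  ∀ v x y : U, (∃ g ∈ colorAut G π, g v = v ∧ g x = y) ↔ IR G π v x = IR G π v y

/-- `(G, π)` is Tinhofer: orbits and colors coincide after individualizing any vertex, and the
same holds recursively for the colored graphs obtained by individualizing any vertices
`v₁, …, vₖ` one after another. -/
def IsTinhofer {U : Type u} [Fintype U] (G : SimpleGraph U) (π : U → ℕ) : Prop :=
  ∀ vs : List U, OrbitsAreColors G (vs.foldl (IR G) π)

/-! ### The model graph -/

/-- The vertices of the model graph of `F`: the literals and the clauses. -/
abbrev Vertex {V : Type u} (F : Formula V) : Type u := Lit V ⊕ {C : Finset (Lit V) // C ∈ F}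

/-- The adjacency relation of the model graph. -/
def modelAdj {V : Type u} (F : Formula V) : Vertex F → Vertex F → Prop
  | .inl a, .inl b => b = neg a
  | .inl a, .inr C => a ∈ C.1
  | .inr C, .inl a => a ∈ C.1
  | .inr _, .inr _ => False

/-- The model graph: a literal is joined to its negation and to the clauses containing it. -/
def modelGraph {V : Type u} (F : Formula V) : SimpleGraph (Vertex F) where
  Adj := modelAdj F
  symm := ⟨by
    rintro (a | C) (b | D) h
    · simp only [modelAdj] at h ⊢
      simp [h, neg]
    · exact h
    · exact h
    · exact h⟩
  loopless := ⟨by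
    rintro (⟨v, b⟩ | C) h
    · cases b <;> simp [modelAdj, neg] at h
    · exact h⟩

/-- The coloring of the model graph: literals get color `0`, clauses get color `1`. -/
def modelColoring {V : Type u} (F : Formula V) : Vertex F → ℕ
  | .inl _ => 0
  | .inr _ => 1

/-! ### Disjoint direct decompositions and Johnson symmetry -/

/-- The partition `P` of the literals is a disjoint direct decomposition: `Aut(F)` is the
product of subgroups `A c`, one for each class `c` of `P`, such that `A c` only moves literals
in `c`. (As the supports are pairwise disjoint, the subgroups commute and are independent, so the
product is direct.) -/
def IsDisjointDirectDecomposition {V : Type u} (F : Formula V) (P : Setoid (Lit V)) : Prop :=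
  ∃ A : Quotient P → Subgroup (Equiv.Perm (Lit V)),
    (∀ c, ∀ g ∈ A c, ∀ l : Lit V, Quotient.mk P l ≠ c → g l = l) ∧ ⨆ c, A c = Aut F

/-- `L` is a disjoint direct factor of `F`: a class of the finest disjoint direct
decomposition. -/
def IsDisjointDirectFactor {V : Type u} (F : Formula V) (L : Set (Lit V)) : Prop :=
  ∃ P : Setoid (Lit V), IsLeast {Q | IsDisjointDirectDecomposition F Q} P ∧ L ∈ P.classes

/-- `Sym(n)`, as the group of permutations of `ℕ` that fix everything outside
`[n] = {1, …, n}`. -/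
def symGroup (n : ℕ) : Subgroup (Equiv.Perm ℕ) where
  carrier := {τ | ∀ k, k ∉ Finset.Icc 1 n → τ k = k}
  one_mem' := fun _ _ => rfl
  mul_mem' := by
    intro g h hg hh k hk
    simp [hh k hk, hg k hk]
  inv_mem' := by
    intro g hg k hk
    exact Equiv.Perm.inv_eq_iff_eq.mpr (hg k hk).symm

/-- The `2`-subsets of `[n] = {1, …, n}`. -/
def twoSubsets (n : ℕ) : Finset (Finset ℕ) := (Finset.Icc 1 n).powersetCard 2

/-- `F` exhibits a Johnson symmetry with Johnson group `J_n` on `σ`, via the labeling `b` of the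
literals in `σ` by the `2`-subsets of `[n]`. -/
structure ExhibitsJohnson {V : Type u} (F : Formula V) (σ : Finset (Lit V)) (n : ℕ)
    (b : Lit V → Finset ℕ) : Prop where
  /-- `σ` is an orbit of `Aut(F)` -/
  orbit : ∃ l : Lit V, (σ : Set (Lit V)) = MulAction.orbit (Aut F) l
  /-- `σ` and its negation form a disjoint direct factor -/
  factor : IsDisjointDirectFactor F ((σ : Set (Lit V)) ∪ neg '' (σ : Set (Lit V)))
  /-- `b` labels `σ` bijectively by the `2`-subsets of `[n]` -/
  bij : Set.BijOn b (σ : Set (Lit V)) (twoSubsets n : Set (Finset ℕ))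
  /-- every element of `Aut(F)` acts on `σ` as an element of `J_n` -/
  act : ∀ g ∈ Aut F, ∃ τ ∈ symGroup n, ∀ l ∈ σ, b (g l) = (b l).image τ
  /-- every element of `J_n` arises in this way -/
  full : ∀ τ ∈ symGroup n, ∃ g ∈ Aut F, ∀ l ∈ σ, b (g l) = (b l).image τ

/-- The permutation of `σ` induced by `τ` through the labeling `b`, i.e. by mapping the literal
labeled `{i, j}` to the one labeled `{τ i, τ j}`; literals outside `σ` are fixed. -/
def inducedPerm {V : Type u} (σ : Finset (Lit V)) (b : Lit V → Finset ℕ) (τ : Equiv.Perm ℕ)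
    (l : Lit V) : Lit V :=
  if h : l ∈ σ ∧ ∃ x ∈ σ, b x = (b l).image τ then h.2.choose else l

/-- The extension of a permutation of the literals to the negations of the literals it moves. -/
def expand {V : Type u} (φ : Lit V → Lit V) (l : Lit V) : Lit V :=
  if φ l ≠ l then φ l else if φ (neg l) ≠ neg l then neg (φ (neg l)) else l

/-! ### The detection algorithm -/

/-- The variables of the main loop: the lists `label[v]`, the adjacency sets `ad[v]` and the next
unused label `vnr`. -/
structure State (V : Type u) where
  label : Lit V → List ℕ
  ad : Lit V → Finset (Lit V)
  vnr : ℕ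

/-- A rule for the arbitrary choices in the algorithm; every choice may depend on the
current state. -/
structure Choices (V : Type u) where
  /-- the choice of `v` among the literals that are not completely labeled -/
  vertex : State V → ∀ A : Finset (Lit V), A.Nonempty → {x // x ∈ A}
  /-- the choice of `w` in `ad[v]` -/
  neighbor : State V → ∀ A : Finset (Lit V), A.Nonempty → {x // x ∈ A}
  /-- the smaller non-singleton fragment for `x`, in the event of a tie -/
  fragment : State V → Lit V → ∀ Q : Finset (Finset (Lit V)), Q.Nonempty → {S // S ∈ Q}

/-- The fragments of `σ` in the coloring `π` of the model graph. -/
def fragments {V : Type u} (F : Formula V) (σ : Finset (Lit V)) (π : Vertex F → ℕ) :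
    Finset (Finset (Lit V)) :=
  σ.image fun x => σ.filter fun y => π (Sum.inl y) = π (Sum.inl x)

/-- The non-singleton members of `Q` of smallest size. -/
def smallerFragments {V : Type u} (Q : Finset (Finset (Lit V))) : Finset (Finset (Lit V)) :=
  Q.filter fun S => 1 < S.card ∧ ∀ T ∈ Q, 1 < T.card → S.card ≤ T.card

/-- The coloring `π' = IR(G(F), ε)`. -/
def baseColoring {V : Type u} [Fintype V] (F : Formula V) : Vertex F → ℕ :=
  colorRefine (modelGraph F) (modelColoring F)

/-- Individualize `x`, check that `σ` has `3` fragments and add the elements of the smaller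
non-singleton fragment to `ad[x]`; the result is the new `ad`, or `none` if the check fails. -/
def explore {V : Type u} [Fintype V] (ch : Choices V) (F : Formula V) (σ : Finset (Lit V))
    (s : State V) (ad : Lit V → Finset (Lit V)) (x : Lit V) : Option (Lit V → Finset (Lit V)) :=
  let Q := fragments F σ (IR (modelGraph F) (baseColoring F) (Sum.inl x))
  if Q.card = 3 then
    if h : (smallerFragments Q).Nonempty then
      some (Function.update ad x (ad x ∪ (ch.fragment s x _ h).1))
    else none
  else none

/-- If the lists `label[x]`, `x ∈ E`, have no common entry, append `vnr` to each of them and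
increase `vnr`. -/
def mark {V : Type u} (s : State V) (E : Finset (Lit V)) : State V :=
  if ∃ k, ∀ x ∈ E, k ∈ s.label x then s
  else
    { s with
      label := fun x => if x ∈ E then s.label x ++ [s.vnr] else s.label x
      vnr := s.vnr + 1 }

/-- The literals different from `v` and `w` that form a singleton fragment of `σ` in
`π_{v,w} = IR((G, π_v), w)`. -/
def thirdSingletons {V : Type u} [Fintype V] (F : Formula V) (σ : Finset (Lit V))
    (v w : Lit V) : Finset (Lit V) :=
  let πv := IR (modelGraph F) (baseColoring F) (Sum.inl v)
  let πvw := IR (modelGraph F) πv (Sum.inl w)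
  σ.filter fun y => y ≠ v ∧ y ≠ w ∧ {y} ∈ fragments F σ πvw

/-- The body of the main loop, after `v` has been chosen; `none` means that the algorithm
returns `⊥`. -/
def iteration {V : Type u} [Fintype V] (ch : Choices V) (F : Formula V) (σ : Finset (Lit V))
    (s : State V) (v : Lit V) : Option (State V) := do
  let ad₁ ← explore ch F σ s s.ad v
  if hw : (ad₁ v).Nonempty then do
    let w : Lit V := (ch.neighbor s (ad₁ v) hw).1
    let ad₂ ← explore ch F σ s ad₁ w
    if hy : ∃ y, thirdSingletons F σ v w = {y} then do
      let y : Lit V := hy.choose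
      let ad ← explore ch F σ s ad₂ y
      let Ei := {v, y} ∪ (ad v ∩ ad y).erase w
      let Ej := {v, w} ∪ (ad v ∩ ad w).erase y
      let Ek := {w, y} ∪ (ad w ∩ ad y).erase v
      let s' := mark (mark (mark { s with ad := ad } Ei) Ej) Ek
      if s'.vnr = s.vnr then none else some s'
    else none
  else none

/-- The literals in `σ` with at most one label. -/
def unfinished {V : Type u} (σ : Finset (Lit V)) (s : State V) : Finset (Lit V) :=
  σ.filter fun v => (s.label v).length ≤ 1

/-- One test of the loop condition: either the loop is left (`Sum.inl`), with a final state
or with the result `⊥`, or it continues with a new state (`Sum.inr`). -/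
def loopStep {V : Type u} [Fintype V] (ch : Choices V) (F : Formula V) (σ : Finset (Lit V))
    (s : State V) : Option (State V) ⊕ State V :=
  if h : (unfinished σ s).Nonempty then
    match iteration ch F σ s (ch.vertex s _ h).1 with
    | none => Sum.inl none
    | some s' => Sum.inr s'
  else Sum.inl (some s)

/-- The while loop, as a partial function (it is undefined where the loop does not terminate). -/
def mainLoop {V : Type u} [Fintype V] (ch : Choices V) (F : Formula V) (σ : Finset (Lit V)) :
    State V →. Option (State V) :=
  PFun.fix fun s => Part.some (loopStep ch F σ s)

/-- The assignment of `2`-subsets to literals that is given by the lists `label[v]`. -/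
def labelSet {V : Type u} (label : Lit V → List ℕ) (l : Lit V) : Finset ℕ := (label l).toFinset

/-- The final verification: `label` induces a bijection between `σ` and the `2`-subsets of `[n]`,
and for every `i ∈ [n - 1]` the permutation of `σ` induced by the transposition `(i, i + 1)`,
expanded to the negations, is a symmetry of `F`. -/
def Verified {V : Type u} (F : Formula V) (σ : Finset (Lit V)) (n : ℕ)
    (label : Lit V → List ℕ) : Prop :=
  Set.BijOn (labelSet label) (σ : Set (Lit V)) (twoSubsets n : Set (Finset ℕ)) ∧
    ∀ i ∈ Finset.Icc 1 (n - 1),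
      IsSymmetry F (expand (inducedPerm σ (labelSet label) (Equiv.swap i (i + 1))))

/-- The detection algorithm for Johnson symmetry on input `F` and `σ`, with the choices `ch`.
`some label ∈ detectJohnson ch F σ` means that it terminates and returns `label`, and
`none ∈ detectJohnson ch F σ` that it terminates and returns `⊥`. -/
def detectJohnson {V : Type u} [Fintype V] (ch : Choices V) (F : Formula V)
    (σ : Finset (Lit V)) : Part (Option (Lit V → List ℕ)) :=
  if h : 28 ≤ σ.card ∧ ∃ n : ℕ, σ.card = n.choose 2 then
    (mainLoop ch F σ { label := fun _ => [], ad := fun _ => ∅, vnr := 1 }).map fun r =>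
      r.bind fun s => if Verified F σ (Nat.find h.2) s.label then some s.label else none
  else Part.some none

end

end JohnsonSym

open JohnsonSym

namespace JohnsonSym

open scoped Classical

universe u

/-! ### Color refinement -/

section Refinement

variable {U : Type u} [Fintype U] {G : SimpleGraph U} {π π₁ π₂ : U → ℕ}

/-! Soundness does not depend on the main loop. When `σ` and its negation are disjoint, the
expansion of the permutation induced by `τ` is the only map that acts on `σ` as `τ` does, commutes
with negation and fixes all other literals (`IsInducedBy.ext`). It is therefore multiplicative in
`τ`, and the adjacent transpositions tested at the end generate `Sym(n)`
(`mem_of_adjacent_swaps_mem`).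

For completeness, the Tinhofer property turns the colors that the algorithm sees into orbits of
stabilizers in `Aut(F)`, hence, on `σ`, into orbits of stabilizers of 2-subsets in `Sym(n)`. The
stabilizer of `{i, j}` has three orbits on pairs, told apart by the size of the intersection with
`{i, j}` (`exists_image_eq_iff`); their lengths are `1`, `2(n-2)` and `(n-2).choose 2`. For `n ≥ 8`
the second is smaller than the third, so exploring `v` collects the pairs that meet `b v` in one
point. Stabilizing `{i, j}` and `{i, k}` isolates exactly one more pair, `{j, k}`
(`thirdSingletons_eq`). The pairs meeting both `{p, q}` and `{p, r}` in one point are `{q, r}` and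
the remaining pairs through `p`, so the three sets built in an iteration are the stars of three
points (`pair_union_eq_star`).

A label is thus the name of a point (`LabelInvariant`). Each iteration names a new point of `b v`,
so the loop stops, with all points named by a permutation of `[n]`. The final check succeeds because
`σ ∪ ¬σ` is a disjoint direct factor: each element of the Johnson group comes from a symmetry that
is trivial elsewhere (`ExhibitsJohnson.exists_isInducedBy`). -/

theorem signature_eq_iff {x y : U} :
    signature G π x = signature G π y ↔
      π x = π y ∧ (Finset.univ.filter fun z => G.Adj x z).val.map π =
        (Finset.univ.filter fun z => G.Adj y z).val.map π := by
  unfold signature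
  rw [toLex_inj, Prod.mk.injEq]
  refine and_congr_right fun _ => ⟨fun h => ?_, fun h => by rw [h]⟩
  have := congrArg (fun l : List ℕ => (l : Multiset ℕ)) h
  simpa only [Multiset.sort_eq] using this

/-- The rank counts the signatures strictly below. A smaller signature that occurs is itself counted
by any larger one, so ranks increase strictly and no two signatures are merged. -/
theorem refineStep_eq_iff {x y : U} :
    refineStep G π x = refineStep G π y ↔ signature G π x = signature G π y := by
  have key : ∀ x y : U, signature G π x < signature G π y →
      refineStep G π x < refineStep G π y := by
    intro x y h
    refine Finset.card_lt_card (Finset.ssubset_iff_subset_ne.2 ⟨fun t ht => ?_, fun he => ?_⟩)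
    · rw [Finset.mem_filter] at ht ⊢
      exact ⟨ht.1, ht.2.trans h⟩
    · have : signature G π x ∈ (Finset.univ.image (signature G π)).filter
          fun t => t < signature G π y :=
        Finset.mem_filter.2 ⟨Finset.mem_image_of_mem _ (Finset.mem_univ x), h⟩
      rw [← he] at this
      exact lt_irrefl _ (Finset.mem_filter.1 this).2
  refine ⟨fun h => ?_, fun h => by simp only [refineStep, h]⟩
  rcases lt_trichotomy (signature G π x) (signature G π y) with hlt | heq | hlt
  · exact absurd h (key _ _ hlt).ne
  · exact heq
  · exact absurd h (key _ _ hlt).ne'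

/-- Throughout, `π₂.FactorsThrough π₁` expresses that the color partition of `π₁` is at least as
fine as that of `π₂`. -/
theorem factorsThrough_refineStep : π.FactorsThrough (refineStep G π) := fun _ _ h =>
  (signature_eq_iff.1 (refineStep_eq_iff.1 h)).1

theorem refineStep_mono (h : π₂.FactorsThrough π₁) :
    (refineStep G π₂).FactorsThrough (refineStep G π₁) := by
  intro x y hxy
  rw [refineStep_eq_iff, signature_eq_iff] at hxy ⊢
  refine ⟨h hxy.1, ?_⟩
  -- The coarser coloring is a function of the finer one, so its multisets of neighbor colors are
  -- images of the finer multisets.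
  obtain ⟨f, rfl⟩ : ∃ f : ℕ → ℕ, π₂ = f ∘ π₁ :=
    ⟨Function.extend π₁ π₂ 0, funext fun x => (h.extend_apply 0 x).symm⟩
  rw [← Multiset.map_map, ← Multiset.map_map, hxy.2]

theorem factorsThrough_colorRefine : π.FactorsThrough (colorRefine G π) := by
  unfold colorRefine
  induction Fintype.card U with
  | zero => exact fun _ _ h => h
  | succ k ih =>
    rw [Function.iterate_succ_apply']
    exact fun x y h => ih (factorsThrough_refineStep h)

theorem colorRefine_mono (h : π₂.FactorsThrough π₁) :
    (colorRefine G π₂).FactorsThrough (colorRefine G π₁) := by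
  unfold colorRefine
  induction Fintype.card U with
  | zero => exact h
  | succ k ih =>
    rw [Function.iterate_succ_apply', Function.iterate_succ_apply']
    exact refineStep_mono ih

theorem IR_mono (h : π₂.FactorsThrough π₁) (v : U) :
    (IR G π₂ v).FactorsThrough (IR G π₁ v) := by
  refine colorRefine_mono fun x y hxy => ?_
  unfold individualize at hxy ⊢
  split_ifs at hxy ⊢ with hx hy hy
  · rfl
  · rw [h (Nat.succ_injective hxy)]

theorem colorAut_le_refineStep : colorAut G π ≤ colorAut G (refineStep G π) := by
  rintro g ⟨hg, hc⟩
  refine ⟨hg, fun x => ?_⟩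
  rw [refineStep_eq_iff, signature_eq_iff]
  refine ⟨hc x, ?_⟩
  have : (Finset.univ.filter fun z => G.Adj (g x) z) =
      (Finset.univ.filter fun z => G.Adj x z).map g.toEmbedding := by
    ext z
    simp only [Finset.mem_filter, Finset.mem_univ, true_and, Finset.mem_map_equiv]
    rw [← hg x, Equiv.apply_symm_apply]
  rw [this, Finset.map_val, Multiset.map_map]
  exact Multiset.map_congr rfl fun z _ => hc z

theorem colorAut_le_colorRefine : colorAut G π ≤ colorAut G (colorRefine G π) := by
  unfold colorRefine
  induction Fintype.card U with
  | zero => exact le_rfl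
  | succ k ih =>
    rw [Function.iterate_succ_apply']
    exact ih.trans colorAut_le_refineStep

theorem mem_colorAut_IR {g : Equiv.Perm U} (hg : g ∈ colorAut G π) {v : U} (hv : g v = v) :
    g ∈ colorAut G (IR G π v) := by
  refine colorAut_le_colorRefine ⟨hg.1, fun x => ?_⟩
  unfold individualize
  have : g x = v ↔ x = v := ⟨fun h => g.injective (h.trans hv.symm), fun h => by rw [h, hv]⟩
  simp only [this, hg.2 x]

/-- Refinement never merges colors, and `v` is the only vertex of color `0` after individualization.
With `mem_colorAut_IR`, the group after individualizing `v` is the stabilizer of `v`; this is what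
allows a second vertex to be individualized. -/
theorem mem_colorAut_of_IR {g : Equiv.Perm U} {v : U} (hg : g ∈ colorAut G (IR G π v)) :
    g ∈ colorAut G π ∧ g v = v := by
  have key : ∀ x, individualize π v (g x) = individualize π v x := fun x =>
    factorsThrough_colorRefine (hg.2 x)
  have hv : g v = v := by
    have := key v
    unfold individualize at this
    by_contra hne
    simp [hne] at this
  refine ⟨⟨hg.1, fun x => ?_⟩, hv⟩
  have := key x
  unfold individualize at this
  by_cases hx : x = v
  · rw [hx, hv]
  · have hgx : g x ≠ v := fun h => hx (g.injective (h.trans hv.symm))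
    simpa [hx, hgx] using this

/-- In a Tinhofer graph, the colors after refining, individualizing `v` and refining again are the
orbits of the stabilizer of `v`. -/
theorem IsTinhofer.IR_colorRefine_eq_iff (hT : IsTinhofer G π) (v x y : U) :
    IR G (colorRefine G π) v x = IR G (colorRefine G π) v y ↔
      ∃ g ∈ colorAut G π, g v = v ∧ g x = y := by
  constructor
  · intro h
    -- Refining beforehand can only make the final coloring finer than the one in the Tinhofer
    -- condition, and automorphisms prevent it from splitting orbits.
    exact (hT [] v x y).2 (IR_mono factorsThrough_colorRefine v h)
  · rintro ⟨g, hg, hv, rfl⟩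
    exact ((mem_colorAut_IR (colorAut_le_colorRefine hg) hv).2 x).symm

/-- The analogue of `IsTinhofer.IR_colorRefine_eq_iff` for two individualized vertices. -/
theorem IsTinhofer.IR_IR_colorRefine_eq_iff (hT : IsTinhofer G π) (v w x y : U) :
    IR G (IR G (colorRefine G π) v) w x = IR G (IR G (colorRefine G π) v) w y ↔
      ∃ g ∈ colorAut G π, g v = v ∧ g w = w ∧ g x = y := by
  constructor
  · intro h
    obtain ⟨g, hg, hw, hx⟩ :=
      (hT [v] w x y).2 (IR_mono (IR_mono factorsThrough_colorRefine v) w h)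
    obtain ⟨hg', hv⟩ := mem_colorAut_of_IR hg
    exact ⟨g, hg', hv, hw, hx⟩
  · rintro ⟨g, hg, hv, hw, rfl⟩
    exact ((mem_colorAut_IR (mem_colorAut_IR (colorAut_le_colorRefine hg) hv) hw).2 x).symm

end Refinement

/-! ### Automorphisms of the model graph -/

section ModelGraph

variable {V : Type u} {F : Formula V}

theorem neg_neg (l : Lit V) : neg (neg l) = l := by simp [neg]

theorem neg_ne (l : Lit V) : neg l ≠ l := by
  obtain ⟨v, b⟩ := l
  cases b <;> simp [neg]

theorem neg_injective : Function.Injective (neg : Lit V → Lit V) :=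
  Function.LeftInverse.injective neg_neg

theorem exists_mem_colorAut_of_mem_Aut {h : Equiv.Perm (Lit V)} (hh : h ∈ Aut F) :
    ∃ g ∈ colorAut (modelGraph F) (modelColoring F), ∀ l, g (Sum.inl l) = Sum.inl (h l) := by
  obtain ⟨-, hneg, hF⟩ := hh
  have hmem : ∀ C ∈ F, C.image h ∈ F := fun C hC => by
    have := Finset.mem_image_of_mem (fun C : Finset (Lit V) => C.image h) hC
    rwa [hF] at this
  let c : {C // C ∈ F} → {C // C ∈ F} := fun C => ⟨C.1.image h, hmem C.1 C.2⟩
  have cinj : Function.Injective c := fun C D hCD =>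
    Subtype.ext (Finset.image_injective h.injective (congrArg Subtype.val hCD))
  have cbij : Function.Bijective c := Finite.injective_iff_bijective.1 cinj
  refine ⟨Equiv.sumCongr h (Equiv.ofBijective c cbij), ⟨?_, ?_⟩, fun l => rfl⟩
  · rintro (a | C) (b | D)
    · change h b = neg (h a) ↔ b = neg a
      rw [← hneg, h.injective.eq_iff]
    · exact h.injective.mem_finset_image
    · exact h.injective.mem_finset_image
    · exact Iff.rfl
  · rintro (a | C) <;> rfl

variable [Fintype V]

theorem exists_mem_Aut_of_mem_colorAut {g : Equiv.Perm (Vertex F)}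
    (hg : g ∈ colorAut (modelGraph F) (modelColoring F)) :
    ∃ h ∈ Aut F, ∀ l, g (Sum.inl l) = Sum.inl (h l) := by
  obtain ⟨hadj, hcol⟩ := hg
  have hl : ∀ l, ∃ l', g (Sum.inl l) = Sum.inl l' := by
    intro l
    have := hcol (Sum.inl l)
    rcases hgl : g (Sum.inl l) with l' | C
    · exact ⟨l', rfl⟩
    · rw [hgl] at this
      simp [modelColoring] at this
  have hr : ∀ C, ∃ D, g (Sum.inr C) = Sum.inr D := by
    intro C
    have := hcol (Sum.inr C)
    rcases hgl : g (Sum.inr C) with l' | D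
    · rw [hgl] at this
      simp [modelColoring] at this
    · exact ⟨D, rfl⟩
  choose f hf using hl
  choose c hc using hr
  have finj : Function.Injective f := fun a b h => by
    have : g (Sum.inl a) = g (Sum.inl b) := by rw [hf, hf, h]
    exact Sum.inl_injective (g.injective this)
  have fbij : Function.Bijective f := Finite.injective_iff_bijective.1 finj
  refine ⟨Equiv.ofBijective f fbij, ⟨fbij, fun l => ?_, ?_⟩, hf⟩
  -- The only literal adjacent to a literal is its negation.
  · have : modelAdj F (Sum.inl l) (Sum.inl (neg l)) := rfl
    have := (hadj (Sum.inl l) (Sum.inl (neg l))).2 this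
    rw [hf, hf] at this
    exact this
  -- An injective image of the clause set has as many members as `F`, so inclusion suffices; clauses
  -- are determined by their neighbors, so the image of `C` is the clause `c C`.
  · refine Finset.eq_of_subset_of_card_le ?_
      (Finset.card_image_of_injective _ (Finset.image_injective finj)).ge
    intro D hD
    obtain ⟨C, hC, rfl⟩ := Finset.mem_image.1 hD
    have : C.image (Equiv.ofBijective f fbij) = (c ⟨C, hC⟩).1 := by
      ext a
      obtain ⟨a, rfl⟩ := fbij.2 a
      have := hadj (Sum.inl a) (Sum.inr ⟨C, hC⟩)
      rw [hf, hc] at this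
      have this : f a ∈ (c ⟨C, hC⟩).1 ↔ a ∈ C := this
      rw [this, Equiv.coe_ofBijective, finj.mem_finset_image]
    rw [this]
    exact (c ⟨C, hC⟩).2

theorem IsTinhofer.IR_baseColoring_eq_iff (hT : IsTinhofer (modelGraph F) (modelColoring F))
    (v x y : Lit V) :
    IR (modelGraph F) (baseColoring F) (Sum.inl v) (Sum.inl x) =
        IR (modelGraph F) (baseColoring F) (Sum.inl v) (Sum.inl y) ↔
      ∃ h ∈ Aut F, h v = v ∧ h x = y := by
  refine (hT.IR_colorRefine_eq_iff _ _ _).trans ⟨?_, ?_⟩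
  · rintro ⟨g, hg, hv, hx⟩
    obtain ⟨h, hh, hgh⟩ := exists_mem_Aut_of_mem_colorAut hg
    rw [hgh] at hv hx
    exact ⟨h, hh, Sum.inl_injective hv, Sum.inl_injective hx⟩
  · rintro ⟨h, hh, hv, hx⟩
    obtain ⟨g, hg, hgh⟩ := exists_mem_colorAut_of_mem_Aut hh
    exact ⟨g, hg, by rw [hgh, hv], by rw [hgh, hx]⟩

theorem IsTinhofer.IR_IR_baseColoring_eq_iff
    (hT : IsTinhofer (modelGraph F) (modelColoring F)) (v w x y : Lit V) :
    IR (modelGraph F) (IR (modelGraph F) (baseColoring F) (Sum.inl v)) (Sum.inl w) (Sum.inl x) =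
        IR (modelGraph F) (IR (modelGraph F) (baseColoring F) (Sum.inl v)) (Sum.inl w)
          (Sum.inl y) ↔
      ∃ h ∈ Aut F, h v = v ∧ h w = w ∧ h x = y := by
  refine (hT.IR_IR_colorRefine_eq_iff _ _ _ _).trans ⟨?_, ?_⟩
  · rintro ⟨g, hg, hv, hw, hx⟩
    obtain ⟨h, hh, hgh⟩ := exists_mem_Aut_of_mem_colorAut hg
    rw [hgh] at hv hw hx
    exact ⟨h, hh, Sum.inl_injective hv, Sum.inl_injective hw, Sum.inl_injective hx⟩
  · rintro ⟨h, hh, hv, hw, hx⟩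
    obtain ⟨g, hg, hgh⟩ := exists_mem_colorAut_of_mem_Aut hh
    exact ⟨g, hg, by rw [hgh, hv], by rw [hgh, hw], by rw [hgh, hx]⟩

end ModelGraph

/-! ### The symmetric group on `[n]` -/

theorem mem_symGroup {n : ℕ} {τ : Equiv.Perm ℕ} :
    τ ∈ symGroup n ↔ ∀ k, k ∉ Finset.Icc 1 n → τ k = k := Iff.rfl

theorem apply_mem_Icc {n : ℕ} {τ : Equiv.Perm ℕ} (hτ : τ ∈ symGroup n) {k : ℕ} :
    τ k ∈ Finset.Icc 1 n ↔ k ∈ Finset.Icc 1 n := by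
  constructor
  · intro h
    by_contra hk
    exact hk (by rwa [mem_symGroup.1 hτ k hk] at h)
  · intro h
    by_contra hk
    exact hk (by rwa [τ.injective (mem_symGroup.1 hτ _ hk)])

theorem swap_mem_symGroup {n i j : ℕ} (hi : i ∈ Finset.Icc 1 n) (hj : j ∈ Finset.Icc 1 n) :
    Equiv.swap i j ∈ symGroup n := fun _ hk =>
  Equiv.swap_apply_of_ne_of_ne (fun h => hk (h ▸ hi)) (fun h => hk (h ▸ hj))

/-- The adjacent transpositions generate `Sym(n)`. -/
theorem mem_of_adjacent_swaps_mem {n : ℕ} (S : Submonoid (Equiv.Perm ℕ))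
    (hS : ∀ i ∈ Finset.Icc 1 (n - 1), Equiv.swap i (i + 1) ∈ S) {τ : Equiv.Perm ℕ}
    (hτ : τ ∈ symGroup n) : τ ∈ S := by
  induction n generalizing τ with
  | zero =>
    have : τ = 1 := Equiv.ext fun k => mem_symGroup.1 hτ k (by simp)
    exact this ▸ S.one_mem
  | succ n ih =>
    have hswap : ∀ m a : ℕ, 1 ≤ a → a + m ≤ n + 1 → Equiv.swap a (a + m) ∈ S := by
      intro m
      induction m with
      | zero =>
        intro a _ _
        rw [add_zero, Equiv.swap_self]
        exact S.one_mem
      | succ m ihm =>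
        intro a ha hle
        rcases Nat.eq_zero_or_pos m with rfl | hm
        · exact hS a (Finset.mem_Icc.2 ⟨ha, by omega⟩)
        · have h₁ := ihm a ha (by omega)
          have h₂ := hS (a + m) (Finset.mem_Icc.2 ⟨by omega, by omega⟩)
          -- The transposition of `a` and `a + m + 1` is a conjugate of an adjacent one by the
          -- transposition of `a` and `a + m`.
          have := Equiv.swap_mul_swap_mul_swap (x := a + m + 1) (y := a + m) (z := a)
            (by omega) (by omega)
          rw [← add_assoc, ← this, Equiv.swap_comm (a + m + 1), Equiv.swap_comm (a + m) a]
          exact S.mul_mem (S.mul_mem h₁ h₂) h₁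
    have hlast : τ (n + 1) ∈ Finset.Icc 1 (n + 1) := (apply_mem_Icc hτ).2 (by simp)
    have hsw : Equiv.swap (τ (n + 1)) (n + 1) ∈ S := by
      rw [Finset.mem_Icc] at hlast
      have := hswap (n + 1 - τ (n + 1)) (τ (n + 1)) hlast.1 (by omega)
      rwa [Nat.add_sub_cancel' hlast.2] at this
    -- This product fixes `n + 1`, which reduces the claim to `Sym(n)`.
    have hmem : Equiv.swap (τ (n + 1)) (n + 1) * τ ∈ symGroup n := by
      intro k hk
      rcases eq_or_ne k (n + 1) with rfl | hne
      · simp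
      · have hk' : k ∉ Finset.Icc 1 (n + 1) := by
          rw [Finset.mem_Icc] at hk ⊢
          omega
        rw [Equiv.Perm.mul_apply, mem_symGroup.1 hτ k hk']
        exact mem_symGroup.1 (swap_mem_symGroup hlast (by simp)) k hk'
    have := S.mul_mem hsw (ih (fun i hi => hS i (by
      rw [Finset.mem_Icc] at hi ⊢
      omega)) hmem)
    rwa [← mul_assoc, Equiv.swap_mul_self, one_mul] at this

theorem mem_twoSubsets {n : ℕ} {T : Finset ℕ} :
    T ∈ twoSubsets n ↔ T ⊆ Finset.Icc 1 n ∧ T.card = 2 := Finset.mem_powersetCard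

theorem image_mem_twoSubsets {n : ℕ} {τ : Equiv.Perm ℕ} (hτ : τ ∈ symGroup n) {T : Finset ℕ}
    (hT : T ∈ twoSubsets n) : T.image τ ∈ twoSubsets n := by
  rw [mem_twoSubsets] at hT ⊢
  refine ⟨fun k hk => ?_, by rw [Finset.card_image_of_injective _ τ.injective, hT.2]⟩
  obtain ⟨a, ha, rfl⟩ := Finset.mem_image.1 hk
  exact (apply_mem_Icc hτ).2 (hT.1 ha)

/-! ### Induced permutations and their expansions -/

section Induced

variable {V : Type u} {F : Formula V} {σ : Finset (Lit V)} {b : Lit V → Finset ℕ} {n : ℕ}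

/-- The map `f` acts on `σ` as prescribed by `τ` and the labeling `b`, accordingly on the negation
of `σ`, and trivially elsewhere. -/
structure IsInducedBy (σ : Finset (Lit V)) (b : Lit V → Finset ℕ) (τ : Equiv.Perm ℕ)
    (f : Lit V → Lit V) : Prop where
  mem : ∀ l ∈ σ, f l ∈ σ
  label : ∀ l ∈ σ, b (f l) = (b l).image τ
  neg : ∀ l, f (neg l) = neg (f l)
  fix : ∀ l, l ∉ σ → JohnsonSym.neg l ∉ σ → f l = l

theorem inducedPerm_spec (hb : Set.BijOn b σ (twoSubsets n : Set (Finset ℕ)))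
    {τ : Equiv.Perm ℕ} (hτ : τ ∈ symGroup n) {l : Lit V} (hl : l ∈ σ) :
    inducedPerm σ b τ l ∈ σ ∧ b (inducedPerm σ b τ l) = (b l).image τ := by
  have h : l ∈ σ ∧ ∃ x ∈ σ, b x = (b l).image τ :=
    ⟨hl, hb.surjOn (image_mem_twoSubsets hτ (hb.mapsTo hl))⟩
  rw [inducedPerm, dif_pos h]
  exact h.2.choose_spec

theorem inducedPerm_of_notMem {τ : Equiv.Perm ℕ} {l : Lit V} (hl : l ∉ σ) :
    inducedPerm σ b τ l = l := dif_neg fun h => hl h.1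

/-- Disjointness from the negation matters when `l` is fixed: otherwise the second branch of
`expand` could still move `l` on account of `neg l`. -/
theorem expand_inducedPerm_of_mem (hσ : ∀ l ∈ σ, neg l ∉ σ) {τ : Equiv.Perm ℕ} {l : Lit V}
    (hl : l ∈ σ) : expand (inducedPerm σ b τ) l = inducedPerm σ b τ l := by
  unfold expand
  rw [inducedPerm_of_notMem (hσ l hl)]
  by_cases h : inducedPerm σ b τ l = l <;> simp [h]

theorem expand_inducedPerm_of_neg_mem (hσ : ∀ l ∈ σ, neg l ∉ σ) {τ : Equiv.Perm ℕ} {l : Lit V}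
    (hl : neg l ∈ σ) :
    expand (inducedPerm σ b τ) l = neg (inducedPerm σ b τ (neg l)) := by
  unfold expand
  rw [inducedPerm_of_notMem (l := l) (fun h => hσ l h hl)]
  by_cases h : inducedPerm σ b τ (neg l) = neg l <;> simp [h, neg_neg]

theorem expand_inducedPerm_of_notMem {τ : Equiv.Perm ℕ} {l : Lit V}
    (hl : l ∉ σ) (hl' : neg l ∉ σ) : expand (inducedPerm σ b τ) l = l := by
  unfold expand
  simp [inducedPerm_of_notMem hl, inducedPerm_of_notMem hl']

theorem isInducedBy_expand (hb : Set.BijOn b σ (twoSubsets n : Set (Finset ℕ)))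
    (hσ : ∀ l ∈ σ, neg l ∉ σ) {τ : Equiv.Perm ℕ} (hτ : τ ∈ symGroup n) :
    IsInducedBy σ b τ (expand (inducedPerm σ b τ)) where
  mem l hl := by
    rw [expand_inducedPerm_of_mem hσ hl]
    exact (inducedPerm_spec hb hτ hl).1
  label l hl := by
    rw [expand_inducedPerm_of_mem hσ hl]
    exact (inducedPerm_spec hb hτ hl).2
  neg l := by
    by_cases hl : l ∈ σ
    · rw [expand_inducedPerm_of_mem hσ hl,
        expand_inducedPerm_of_neg_mem hσ (by rwa [neg_neg]), neg_neg]
    · by_cases hl' : JohnsonSym.neg l ∈ σ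
      · rw [expand_inducedPerm_of_mem hσ hl', expand_inducedPerm_of_neg_mem hσ hl', neg_neg]
      · rw [expand_inducedPerm_of_notMem hl hl',
          expand_inducedPerm_of_notMem hl' (by rwa [neg_neg])]
  fix l hl hl' := expand_inducedPerm_of_notMem hl hl'

/-- Labels determine the values on `σ`, and negation then determines those on `¬σ`. Any symmetry
with the right action can thus be identified with the expanded permutation that the algorithm tests.
-/
theorem IsInducedBy.ext (hb : Set.InjOn b σ) {τ : Equiv.Perm ℕ} {f g : Lit V → Lit V}
    (hf : IsInducedBy σ b τ f) (hg : IsInducedBy σ b τ g) : f = g := by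
  have key : ∀ l ∈ σ, f l = g l := fun l hl =>
    hb (hf.mem l hl) (hg.mem l hl) ((hf.label l hl).trans (hg.label l hl).symm)
  funext l
  by_cases hl : l ∈ σ
  · exact key l hl
  · by_cases hl' : JohnsonSym.neg l ∈ σ
    · exact neg_injective (by rw [← hf.neg, ← hg.neg, key _ hl'])
    · rw [hf.fix l hl hl', hg.fix l hl hl']

theorem IsInducedBy.comp {τ₁ τ₂ : Equiv.Perm ℕ} {f g : Lit V → Lit V}
    (hf : IsInducedBy σ b τ₁ f) (hg : IsInducedBy σ b τ₂ g) :
    IsInducedBy σ b (τ₁ * τ₂) (f ∘ g) where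
  mem l hl := hf.mem _ (hg.mem l hl)
  label l hl := by
    rw [Function.comp_apply, hf.label _ (hg.mem l hl), hg.label l hl, Finset.image_image,
      Equiv.Perm.coe_mul]
  neg l := by simp only [Function.comp_apply, hg.neg, hf.neg]
  fix l hl hl' := by rw [Function.comp_apply, hg.fix l hl hl', hf.fix l hl hl']

theorem isInducedBy_one : IsInducedBy σ b 1 id where
  mem _ hl := hl
  label _ _ := by simp
  neg _ := rfl
  fix _ _ _ := rfl

theorem isSymmetry_id : IsSymmetry F id := (Aut F).one_mem

theorem IsSymmetry.comp {f g : Lit V → Lit V} (hf : IsSymmetry F f) (hg : IsSymmetry F g) :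
    IsSymmetry F (f ∘ g) := by
  have := (Aut F).mul_mem (x := Equiv.ofBijective f hf.1) (y := Equiv.ofBijective g hg.1) hf hg
  exact this

/-- If the adjacent transpositions induce symmetries of `F`, then so does all of `Sym(n)`. -/
theorem isSymmetry_expand_of_adjacent_swaps (hb : Set.BijOn b σ (twoSubsets n : Set (Finset ℕ)))
    (hσ : ∀ l ∈ σ, neg l ∉ σ)
    (hsym : ∀ i ∈ Finset.Icc 1 (n - 1),
      IsSymmetry F (expand (inducedPerm σ b (Equiv.swap i (i + 1)))))
    {τ : Equiv.Perm ℕ} (hτ : τ ∈ symGroup n) : IsSymmetry F (expand (inducedPerm σ b τ)) := by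
  let S : Submonoid (Equiv.Perm ℕ) :=
    { carrier := {τ | ∃ f, IsInducedBy σ b τ f ∧ IsSymmetry F f}
      one_mem' := ⟨id, isInducedBy_one, isSymmetry_id⟩
      mul_mem' := by
        rintro τ₁ τ₂ ⟨f, hf, hf'⟩ ⟨g, hg, hg'⟩
        exact ⟨f ∘ g, hf.comp hg, hf'.comp hg'⟩ }
  have hS : τ ∈ S := mem_of_adjacent_swaps_mem S (fun i hi => by
    refine ⟨_, isInducedBy_expand hb hσ ?_, hsym i hi⟩
    rw [Finset.mem_Icc] at hi
    exact swap_mem_symGroup (Finset.mem_Icc.2 ⟨hi.1, by omega⟩)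
      (Finset.mem_Icc.2 ⟨by omega, by omega⟩)) hτ
  obtain ⟨f, hf, hf'⟩ := hS
  rwa [(isInducedBy_expand hb hσ hτ).ext hb.injOn hf]

end Induced

/-! ### Johnson symmetry -/

section Johnson

variable {V : Type u} {F : Formula V} {σ : Finset (Lit V)} {b : Lit V → Finset ℕ} {n : ℕ}

/-- The restriction of a symmetry to a part of a disjoint direct decomposition is a symmetry. -/
theorem IsDisjointDirectFactor.exists_restrict {L : Set (Lit V)}
    (hL : IsDisjointDirectFactor F L) {g : Equiv.Perm (Lit V)} (hg : g ∈ Aut F) :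
    ∃ h ∈ Aut F, (∀ l ∈ L, h l = g l) ∧ ∀ l ∉ L, h l = l := by
  obtain ⟨P, ⟨⟨A, hA, hsup⟩, -⟩, x, rfl⟩ := hL
  have hmemL : ∀ l, l ∈ {y | P y x} ↔ Quotient.mk P l = Quotient.mk P x := fun l =>
    Quotient.eq.symm
  have hfix : ∀ h ∈ A (Quotient.mk P x), ∀ l ∉ {y | P y x}, h l = l := fun h hh l hl =>
    hA _ h hh l fun he => hl ((hmemL l).2 he)
  -- Invariance of the part is carried along because restrictions of two factors compose only if the
  -- first one stays inside the part.
  suffices H : (∀ l ∈ {y | P y x}, g l ∈ {y | P y x}) ∧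
      ∃ h ∈ A (Quotient.mk P x), ∀ l ∈ {y | P y x}, h l = g l by
    obtain ⟨-, h, hh, hgl⟩ := H
    exact ⟨h, hsup ▸ Subgroup.mem_iSup_of_mem _ hh, hgl, hfix h hh⟩
  rw [← hsup] at hg
  induction hg using Subgroup.iSup_induction' with
  | h1 => exact ⟨fun _ h => h, 1, one_mem _, fun _ _ => rfl⟩
  | hmul g₁ g₂ _ _ ih₁ ih₂ =>
    obtain ⟨m₁, h₁, hh₁, e₁⟩ := ih₁
    obtain ⟨m₂, h₂, hh₂, e₂⟩ := ih₂
    refine ⟨fun l hl => m₁ _ (m₂ l hl), h₁ * h₂, mul_mem hh₁ hh₂, fun l hl => ?_⟩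
    rw [Equiv.Perm.mul_apply, Equiv.Perm.mul_apply, e₂ l hl, e₁ _ (m₂ l hl)]
  | hp c g hg =>
    by_cases hc : c = Quotient.mk P x
    · subst hc
      refine ⟨fun l hl => ?_, g, hg, fun _ _ => rfl⟩
      -- If `g l` lay outside the part, `g` would fix it, and injectivity would give `g l = l`.
      by_contra hne
      exact hne (by rwa [g.injective (hfix g hg _ hne)])
    · have : ∀ l ∈ {y | P y x}, g l = l := fun l hl =>
        hA c g hg l fun he => hc (he.symm.trans ((hmemL l).1 hl))
      exact ⟨fun l hl => by rwa [this l hl], 1, one_mem _, fun l hl => (this l hl).symm⟩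

theorem ExhibitsJohnson.apply_mem (hJ : ExhibitsJohnson F σ n b) {g : Equiv.Perm (Lit V)}
    (hg : g ∈ Aut F) {l : Lit V} (hl : l ∈ σ) : g l ∈ σ := by
  obtain ⟨l₀, h₀⟩ := hJ.orbit
  have hl' : l ∈ (σ : Set (Lit V)) := hl
  change g l ∈ (σ : Set (Lit V))
  rw [h₀] at hl' ⊢
  exact MulAction.mem_orbit_of_mem_orbit (⟨g, hg⟩ : Aut F) hl'

/-- Every element of `Sym(n)` induces a symmetry that is trivial outside of `σ ∪ ¬σ`. -/
theorem ExhibitsJohnson.exists_isInducedBy (hJ : ExhibitsJohnson F σ n b) {τ : Equiv.Perm ℕ}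
    (hτ : τ ∈ symGroup n) : ∃ f, IsInducedBy σ b τ f ∧ IsSymmetry F f := by
  obtain ⟨g, hg, hgl⟩ := hJ.full τ hτ
  obtain ⟨h, hh, hL, hfix⟩ := hJ.factor.exists_restrict hg
  refine ⟨h, ⟨fun l hl => hJ.apply_mem hh hl, fun l hl => ?_, hh.2.1, fun l hl hl' => ?_⟩, hh⟩
  · rw [hL l (Or.inl hl), hgl l hl]
  · refine hfix l ?_
    rintro (h | ⟨l', h, rfl⟩)
    · exact hl h
    · exact hl' (by rwa [neg_neg])

/-- The verification step succeeds on every relabeling of a Johnson labeling. -/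
theorem ExhibitsJohnson.verified (hJ : ExhibitsJohnson F σ n b) (hσ : ∀ l ∈ σ, neg l ∉ σ)
    {τ : Equiv.Perm ℕ} (hτ : τ ∈ symGroup n) {label : Lit V → List ℕ}
    (hlabel : ∀ l ∈ σ, labelSet label l = (b l).image τ) : Verified F σ n label := by
  have himage : Set.BijOn (fun T : Finset ℕ => T.image τ) (twoSubsets n : Set (Finset ℕ))
      (twoSubsets n : Set (Finset ℕ)) := by
    refine ⟨fun T hT => image_mem_twoSubsets hτ hT,
      (Finset.image_injective τ.injective).injOn, fun T hT =>
      ⟨T.image (τ⁻¹ : Equiv.Perm ℕ), image_mem_twoSubsets (inv_mem hτ) hT, ?_⟩⟩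
    change (T.image (τ⁻¹ : Equiv.Perm ℕ)).image τ = T
    rw [Finset.image_image, ← Equiv.Perm.coe_mul, mul_inv_cancel, Equiv.Perm.coe_one,
      Finset.image_id]
  have hbij : Set.BijOn (labelSet label) (σ : Set (Lit V)) (twoSubsets n : Set (Finset ℕ)) :=
    (himage.comp hJ.bij).congr fun l hl => (hlabel l hl).symm
  refine ⟨hbij, fun i hi => ?_⟩
  rw [Finset.mem_Icc] at hi
  have hsw : Equiv.swap i (i + 1) ∈ symGroup n :=
    swap_mem_symGroup (Finset.mem_Icc.2 ⟨hi.1, by omega⟩) (Finset.mem_Icc.2 ⟨by omega, by omega⟩)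
  -- The new labels are the `τ`-images of the old ones, so a transposition read through `label` is
  -- its conjugate by `τ` read through `b`.
  obtain ⟨f, hf, hsym⟩ :=
    hJ.exists_isInducedBy (mul_mem (mul_mem (inv_mem hτ) hsw) hτ)
  have hf' : IsInducedBy σ (labelSet label) (Equiv.swap i (i + 1)) f := by
    refine ⟨hf.mem, fun l hl => ?_, hf.neg, hf.fix⟩
    rw [hlabel _ (hf.mem l hl), hf.label l hl, hlabel l hl, Finset.image_image,
      Finset.image_image, ← Equiv.Perm.coe_mul, ← Equiv.Perm.coe_mul]
    congr 2
    group
  rwa [(isInducedBy_expand hbij hσ hsw).ext hbij.injOn hf']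

end Johnson

/-! ### Two-element sets of points -/

section Points

variable {n : ℕ}

/-- Multiple transitivity of a full symmetric group, with permutations of `[n]` extended by the
identity to `ℕ`. -/
theorem exists_mem_symGroup_apply_eq {k : ℕ} {f g : Fin k → ℕ} (hf : Function.Injective f)
    (hg : Function.Injective g) (hf' : ∀ i, f i ∈ Finset.Icc 1 n)
    (hg' : ∀ i, g i ∈ Finset.Icc 1 n) : ∃ τ ∈ symGroup n, ∀ i, τ (f i) = g i := by
  let f' : Fin k ↪ {x // x ∈ Finset.Icc 1 n} :=
    ⟨fun i => ⟨f i, hf' i⟩, fun i j h => hf (congrArg Subtype.val h)⟩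
  let g' : Fin k ↪ {x // x ∈ Finset.Icc 1 n} :=
    ⟨fun i => ⟨g i, hg' i⟩, fun i j h => hg (congrArg Subtype.val h)⟩
  obtain ⟨τ, hτ⟩ := MulAction.isMultiplyPretransitive_iff.1
    (Equiv.Perm.isMultiplyPretransitive {x // x ∈ Finset.Icc 1 n} k) f' g'
  refine ⟨Equiv.Perm.ofSubtype τ, fun x hx => Equiv.Perm.ofSubtype_apply_of_not_mem τ hx,
    fun i => ?_⟩
  rw [Equiv.Perm.ofSubtype_apply_of_mem τ (hf' i)]
  exact congrArg Subtype.val (DFunLike.congr_fun hτ i)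

/-- Exchange a point of `B` outside `S` with a point of `[n]` outside `S ∪ B`, which exists by
counting. -/
theorem exists_mem_symGroup_image_ne {S B : Finset ℕ} (hB : B ⊆ Finset.Icc 1 n)
    (hBS : ¬ B ⊆ S) (hcard : (S ∪ B).card < n) :
    ∃ τ ∈ symGroup n, (∀ i ∈ S, τ i = i) ∧ B.image τ ≠ B := by
  obtain ⟨p, hpB, hpS⟩ := Finset.not_subset.1 hBS
  obtain ⟨q, hq, hqn⟩ : ∃ q ∈ Finset.Icc 1 n, q ∉ S ∪ B :=
    Finset.exists_mem_notMem_of_card_lt_card (by simpa using hcard)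
  rw [Finset.mem_union, not_or] at hqn
  refine ⟨Equiv.swap p q, swap_mem_symGroup (hB hpB) hq, fun i hi =>
    Equiv.swap_apply_of_ne_of_ne (fun h => hpS (h ▸ hi)) (fun h => hqn.1 (h ▸ hi)), fun h => ?_⟩
  have : Equiv.swap p q p ∈ B.image (Equiv.swap p q) := Finset.mem_image_of_mem _ hpB
  rw [Equiv.swap_apply_left, h] at this
  exact hqn.2 this

theorem card_pair_inter {p q : ℕ} (h : p ≠ q) (T : Finset ℕ) :
    (({p, q} : Finset ℕ) ∩ T).card = (if p ∈ T then 1 else 0) + if q ∈ T then 1 else 0 := by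
  by_cases hp : p ∈ T <;> by_cases hq : q ∈ T <;> simp [hp, hq, h]

theorem eq_pair_of_mem {T : Finset ℕ} (hT : T.card = 2) {p q : ℕ} (h : p ≠ q) (hp : p ∈ T)
    (hq : q ∈ T) : T = {p, q} :=
  (Finset.eq_of_subset_of_card_le (Finset.insert_subset hp (Finset.singleton_subset_iff.2 hq))
    (by rw [hT, Finset.card_pair h])).symm

theorem exists_eq_pair_of_mem {T : Finset ℕ} (hT : T.card = 2) {p : ℕ} (hp : p ∈ T) :
    ∃ q, p ≠ q ∧ T = {p, q} := by
  obtain ⟨q, hq, hne⟩ := Finset.exists_mem_ne (by omega : 1 < T.card) p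
  exact ⟨q, hne.symm, eq_pair_of_mem hT hne.symm hp hq⟩

theorem exists_of_card_inter_eq_one {A B : Finset ℕ} (hA : A.card = 2) (hB : B.card = 2)
    (h : (A ∩ B).card = 1) :
    ∃ p q r, p ≠ q ∧ p ≠ r ∧ q ≠ r ∧ A = {p, q} ∧ B = {p, r} := by
  obtain ⟨p, hp⟩ := Finset.card_pos.1 (by omega : 0 < (A ∩ B).card)
  rw [Finset.mem_inter] at hp
  obtain ⟨q, hpq, rfl⟩ := exists_eq_pair_of_mem hA hp.1
  obtain ⟨r, hpr, rfl⟩ := exists_eq_pair_of_mem hB hp.2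
  refine ⟨p, q, r, hpq, hpr, fun h' => ?_, rfl, rfl⟩
  subst h'
  rw [Finset.inter_self, hA] at h
  omega

/-- The orbits of the stabilizer of a `2`-subset of `[n]` on the `2`-subsets of `[n]`. -/
theorem exists_image_eq_iff {A B C : Finset ℕ} (hA : A ∈ twoSubsets n) (hB : B ∈ twoSubsets n)
    (hC : C ∈ twoSubsets n) :
    (∃ τ ∈ symGroup n, A.image τ = A ∧ B.image τ = C) ↔ (A ∩ B).card = (A ∩ C).card := by
  rw [mem_twoSubsets] at hA hB hC
  constructor
  · rintro ⟨τ, -, h₁, rfl⟩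
    conv_rhs => rw [← h₁]
    rw [← Finset.image_inter _ _ τ.injective, Finset.card_image_of_injective _ τ.injective]
  · intro h
    have hle : (A ∩ B).card ≤ 2 := (Finset.card_le_card Finset.inter_subset_left).trans hA.2.le
    obtain h0 | h1 | h2 : (A ∩ B).card = 0 ∨ (A ∩ B).card = 1 ∨ (A ∩ B).card = 2 := by omega
    · rw [h0] at h
      obtain ⟨i, j, hij, rfl⟩ := Finset.card_eq_two.1 hA.2
      obtain ⟨k, l, hkl, rfl⟩ := Finset.card_eq_two.1 hB.2
      obtain ⟨k', l', hkl', rfl⟩ := Finset.card_eq_two.1 hC.2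
      have hAB := Finset.disjoint_iff_inter_eq_empty.2 (Finset.card_eq_zero.1 h0)
      have hAC := Finset.disjoint_iff_inter_eq_empty.2 (Finset.card_eq_zero.1 h.symm)
      simp only [Finset.disjoint_insert_left, Finset.mem_insert, Finset.mem_singleton, not_or,
        Finset.disjoint_singleton_left] at hAB hAC
      simp only [Finset.insert_subset_iff, Finset.singleton_subset_iff] at hA hB hC
      obtain ⟨τ, hτ, hτ'⟩ := exists_mem_symGroup_apply_eq (n := n) (f := ![i, j, k, l])
        (g := ![i, j, k', l'])
        (by intro a b; fin_cases a <;> fin_cases b <;> simp <;> tauto)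
        (by intro a b; fin_cases a <;> fin_cases b <;> simp <;> tauto)
        (by intro a; fin_cases a <;> [exact hA.1.1; exact hA.1.2; exact hB.1.1; exact hB.1.2])
        (by intro a; fin_cases a <;> [exact hA.1.1; exact hA.1.2; exact hC.1.1; exact hC.1.2])
      have e0 : τ i = i := hτ' 0
      have e1 : τ j = j := hτ' 1
      have e2 : τ k = k' := hτ' 2
      have e3 : τ l = l' := hτ' 3
      exact ⟨τ, hτ, by simp [e0, e1], by simp [e2, e3]⟩
    -- `A` may meet `B` and `C` in different points; `τ` then exchanges the two points of `A`.
    · rw [h1] at h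
      obtain ⟨p, q, r, hpq, hpr, hqr, hA₁, rfl⟩ := exists_of_card_inter_eq_one hA.2 hB.2 h1
      obtain ⟨p', q', r', hpq', hpr', hqr', hA₂, rfl⟩ :=
        exists_of_card_inter_eq_one hA.2 hC.2 h.symm
      have hA₁' := hA.1
      have hA₂' := hA.1
      rw [hA₁] at hA₁'
      rw [hA₂] at hA₂'
      simp only [Finset.insert_subset_iff, Finset.singleton_subset_iff] at hA₁' hA₂' hB hC
      obtain ⟨τ, hτ, hτ'⟩ := exists_mem_symGroup_apply_eq (n := n) (f := ![p, q, r])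
        (g := ![p', q', r'])
        (by intro a b; fin_cases a <;> fin_cases b <;> simp <;> tauto)
        (by intro a b; fin_cases a <;> fin_cases b <;> simp <;> tauto)
        (by intro a; fin_cases a <;> [exact hA₁'.1; exact hA₁'.2; exact hB.1.2])
        (by intro a; fin_cases a <;> [exact hA₂'.1; exact hA₂'.2; exact hC.1.2])
      have e0 : τ p = p' := hτ' 0
      have e1 : τ q = q' := hτ' 1
      have e2 : τ r = r' := hτ' 2
      refine ⟨τ, hτ, ?_, by simp [e0, e2]⟩
      conv_lhs => rw [hA₁]
      rw [hA₂]
      simp [e0, e1]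
    · have hAB : A = B := by
        rw [← Finset.eq_of_subset_of_card_le (Finset.inter_subset_left (s₁ := A) (s₂ := B))
          (by omega)]
        exact Finset.eq_of_subset_of_card_le Finset.inter_subset_right (by omega)
      have hAC : A = C := by
        rw [← Finset.eq_of_subset_of_card_le (Finset.inter_subset_left (s₁ := A) (s₂ := C))
          (by omega)]
        exact Finset.eq_of_subset_of_card_le Finset.inter_subset_right (by omega)
      exact ⟨1, one_mem _, by simp, by simp [← hAB, ← hAC]⟩

/-- Applied with `m = n - 2`, this is the source of the bound `n ≥ 8`: for `m = 5` both sides equal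
`10`. -/
theorem two_mul_lt_choose_two {m : ℕ} (hm : 6 ≤ m) : 2 * m < m.choose 2 := by
  induction m, hm using Nat.le_induction with
  | base => decide
  | succ m _ ih =>
    have h : (m + 1).choose 2 = m.choose 1 + m.choose 2 := Nat.choose_succ_succ _ _
    rw [Nat.choose_one_right] at h
    omega

end Points

/-! ### Fragments of a Johnson orbit -/

section Fragments

variable {V : Type u} {F : Formula V} {σ : Finset (Lit V)} {b : Lit V → Finset ℕ} {n : ℕ}

/-- The literals in `σ` whose label shares exactly `c` points with the label of `v`. -/
noncomputable def meeting (σ : Finset (Lit V)) (b : Lit V → Finset ℕ) (v : Lit V) (c : ℕ) :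
    Finset (Lit V) :=
  σ.filter fun x => (b v ∩ b x).card = c

/-- The literals in `σ` whose label contains the point `p`. -/
noncomputable def star (σ : Finset (Lit V)) (b : Lit V → Finset ℕ) (p : ℕ) : Finset (Lit V) :=
  σ.filter fun x => p ∈ b x

theorem mem_meeting {v x : Lit V} {c : ℕ} :
    x ∈ meeting σ b v c ↔ x ∈ σ ∧ (b v ∩ b x).card = c := Finset.mem_filter

theorem mem_star {p : ℕ} {x : Lit V} : x ∈ star σ b p ↔ x ∈ σ ∧ p ∈ b x := Finset.mem_filter

namespace ExhibitsJohnson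

theorem label_subset (hJ : ExhibitsJohnson F σ n b) {l : Lit V} (hl : l ∈ σ) :
    b l ⊆ Finset.Icc 1 n := (mem_twoSubsets.1 (hJ.bij.mapsTo hl)).1

theorem card_label (hJ : ExhibitsJohnson F σ n b) {l : Lit V} (hl : l ∈ σ) : (b l).card = 2 :=
  (mem_twoSubsets.1 (hJ.bij.mapsTo hl)).2

theorem exists_label_eq (hJ : ExhibitsJohnson F σ n b) {p q : ℕ} (hpq : p ≠ q)
    (hp : p ∈ Finset.Icc 1 n) (hq : q ∈ Finset.Icc 1 n) : ∃ l ∈ σ, b l = {p, q} :=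
  hJ.bij.surjOn (mem_twoSubsets.2
    ⟨Finset.insert_subset hp (Finset.singleton_subset_iff.2 hq), Finset.card_pair hpq⟩)

theorem card_eq (hJ : ExhibitsJohnson F σ n b) : σ.card = n.choose 2 := by
  have h : σ.image b = twoSubsets n := by
    rw [← Finset.coe_inj, Finset.coe_image, hJ.bij.image_eq]
  rw [← Finset.card_image_of_injOn hJ.bij.injOn, h, twoSubsets, Finset.card_powersetCard,
    Nat.card_Icc, Nat.add_sub_cancel]

/-- A symmetry fixing `l` fixes `neg l`. If both were in `σ`, some element of the Johnson group
would fix `b l` pointwise and move `b (neg l)`; two pairs cover at most four points, whence `5 ≤ n`.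
-/
theorem neg_notMem (hJ : ExhibitsJohnson F σ n b) (hn : 5 ≤ n) : ∀ l ∈ σ, neg l ∉ σ := by
  intro l hl hl'
  have hns : ¬ b (neg l) ⊆ b l := fun h =>
    neg_ne l (hJ.bij.injOn hl' hl (Finset.eq_of_subset_of_card_le h
      (by rw [hJ.card_label hl, hJ.card_label hl'])))
  obtain ⟨τ, hτ, hfix, hne⟩ := exists_mem_symGroup_image_ne (hJ.label_subset hl') hns (n := n) (by
    have := Finset.card_union_le (b l) (b (neg l))
    rw [hJ.card_label hl, hJ.card_label hl'] at this
    omega)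
  obtain ⟨g, hg, hgl⟩ := hJ.full τ hτ
  have h₁ : g l = l := hJ.bij.injOn (hJ.apply_mem hg hl) hl (by
    rw [hgl l hl]
    exact (Finset.image_congr hfix).trans Finset.image_id)
  apply hne
  rw [← hgl _ hl', hg.2.1, h₁]

/-- Stabilizers of literals in `σ` correspond to stabilizers of `2`-subsets. -/
theorem exists_stabilizer_iff (hJ : ExhibitsJohnson F σ n b) {v w x y : Lit V} (hv : v ∈ σ)
    (hw : w ∈ σ) (hx : x ∈ σ) (hy : y ∈ σ) :
    (∃ h ∈ Aut F, h v = v ∧ h w = w ∧ h x = y) ↔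
      ∃ τ ∈ symGroup n, (b v).image τ = b v ∧ (b w).image τ = b w ∧ (b x).image τ = b y := by
  constructor
  · rintro ⟨h, hh, h₁, h₂, h₃⟩
    obtain ⟨τ, hτ, hτ'⟩ := hJ.act h hh
    exact ⟨τ, hτ, by rw [← hτ' v hv, h₁], by rw [← hτ' w hw, h₂], by rw [← hτ' x hx, h₃]⟩
  · rintro ⟨τ, hτ, h₁, h₂, h₃⟩
    obtain ⟨h, hh, hτ'⟩ := hJ.full τ hτ
    exact ⟨h, hh, hJ.bij.injOn (hJ.apply_mem hh hv) hv (by rw [hτ' v hv, h₁]),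
      hJ.bij.injOn (hJ.apply_mem hh hw) hw (by rw [hτ' w hw, h₂]),
      hJ.bij.injOn (hJ.apply_mem hh hx) hy (by rw [hτ' x hx, h₃])⟩

theorem meeting_two (hJ : ExhibitsJohnson F σ n b) {v : Lit V} (hv : v ∈ σ) :
    meeting σ b v 2 = {v} := by
  ext x
  rw [mem_meeting, Finset.mem_singleton]
  constructor
  · rintro ⟨hx, hc⟩
    have h₁ := Finset.eq_of_subset_of_card_le (Finset.inter_subset_left (s₁ := b v) (s₂ := b x))
      (by rw [hc, hJ.card_label hv])
    have h₂ := Finset.eq_of_subset_of_card_le (Finset.inter_subset_right (s₁ := b v) (s₂ := b x))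
      (by rw [hc, hJ.card_label hx])
    exact hJ.bij.injOn hx hv (h₂.symm.trans h₁)
  · rintro rfl
    exact ⟨hv, by rw [Finset.inter_self, hJ.card_label hv]⟩

theorem card_meeting_zero (hJ : ExhibitsJohnson F σ n b) {v : Lit V} (hv : v ∈ σ) :
    (meeting σ b v 0).card = (n - 2).choose 2 := by
  have h : (meeting σ b v 0).image b = (Finset.Icc 1 n \ b v).powersetCard 2 := by
    ext T
    rw [Finset.mem_image, Finset.mem_powersetCard, Finset.subset_sdiff]
    constructor
    · rintro ⟨x, hx, rfl⟩
      rw [mem_meeting, Finset.card_eq_zero, ← Finset.disjoint_iff_inter_eq_empty] at hx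
      exact ⟨⟨hJ.label_subset hx.1, hx.2.symm⟩, hJ.card_label hx.1⟩
    · rintro ⟨⟨h₁, h₂⟩, h₃⟩
      obtain ⟨x, hx, rfl⟩ := hJ.bij.surjOn (mem_twoSubsets.2 ⟨h₁, h₃⟩)
      refine ⟨x, mem_meeting.2 ⟨hx, ?_⟩, rfl⟩
      rw [Finset.card_eq_zero, ← Finset.disjoint_iff_inter_eq_empty]
      exact h₂.symm
  have hinj : Set.InjOn b (meeting σ b v 0 : Set (Lit V)) :=
    hJ.bij.injOn.mono (Finset.coe_subset.2 (Finset.filter_subset _ _))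
  rw [← Finset.card_image_of_injOn hinj, h, Finset.card_powersetCard,
    Finset.card_sdiff_of_subset (hJ.label_subset hv), Nat.card_Icc, hJ.card_label hv,
    Nat.add_sub_cancel]

theorem card_inter_lt (hJ : ExhibitsJohnson F σ n b) {v : Lit V} (hv : v ∈ σ) (x : Lit V) :
    (b v ∩ b x).card < 3 := by
  have := Finset.card_le_card (Finset.inter_subset_left (s₁ := b v) (s₂ := b x))
  rw [hJ.card_label hv] at this
  omega

/-- By subtraction: the intersection sizes `0`, `1`, `2` partition `σ`, and the other two classes
are already counted. -/
theorem card_meeting_one (hJ : ExhibitsJohnson F σ n b) (hn : 2 ≤ n) {v : Lit V} (hv : v ∈ σ) :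
    (meeting σ b v 1).card = 2 * (n - 2) := by
  have hsum := Finset.card_eq_sum_card_fiberwise (s := σ) (t := Finset.range 3)
    (f := fun x => (b v ∩ b x).card)
    (fun x _ => Finset.mem_coe.2 (Finset.mem_range.2 (hJ.card_inter_lt hv x)))
  change σ.card = ∑ c ∈ Finset.range 3, (meeting σ b v c).card at hsum
  rw [Finset.sum_range_succ, Finset.sum_range_succ, Finset.sum_range_succ, Finset.sum_range_zero,
    hJ.card_meeting_zero hv, hJ.meeting_two hv, Finset.card_singleton, hJ.card_eq] at hsum
  obtain ⟨m, rfl⟩ := Nat.exists_eq_add_of_le' hn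
  have h1 : (m + 2).choose 2 = (m + 1).choose 1 + (m + 1).choose 2 := Nat.choose_succ_succ _ _
  have h2 : (m + 1).choose 2 = m.choose 1 + m.choose 2 := Nat.choose_succ_succ _ _
  rw [Nat.choose_one_right] at h1 h2
  rw [Nat.add_sub_cancel] at hsum ⊢
  omega

theorem card_meeting_one_lt (hJ : ExhibitsJohnson F σ n b) (hn : 8 ≤ n) {v : Lit V}
    (hv : v ∈ σ) : (meeting σ b v 1).card < (meeting σ b v 0).card := by
  rw [hJ.card_meeting_one (by omega) hv, hJ.card_meeting_zero hv]
  exact two_mul_lt_choose_two (by omega)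

/-- A pair that avoids `p` and meets both `{p, q}` and `{p, r}` must be `{q, r}`, the label of the
erased `w`. The literals `v` and `y` are added by hand since neither is its own neighbor. -/
theorem pair_union_eq_star (hJ : ExhibitsJohnson F σ n b) {v w y : Lit V}
    (hv : v ∈ σ) (hw : w ∈ σ) (hy : y ∈ σ) {p q r : ℕ} (hpq : p ≠ q) (hpr : p ≠ r) (hqr : q ≠ r)
    (hbv : b v = {p, q}) (hby : b y = {p, r}) (hbw : b w = {q, r}) :
    {v, y} ∪ (meeting σ b v 1 ∩ meeting σ b y 1).erase w = star σ b p := by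
  ext x
  simp only [Finset.mem_union, Finset.mem_insert, Finset.mem_singleton, Finset.mem_erase,
    Finset.mem_inter, mem_meeting, mem_star, hbv, hby, card_pair_inter hpq, card_pair_inter hpr]
  constructor
  · rintro ((rfl | rfl) | ⟨hxw, ⟨hx, h₁⟩, -, h₂⟩)
    · exact ⟨hv, by simp [hbv]⟩
    · exact ⟨hy, by simp [hby]⟩
    · refine ⟨hx, by_contra fun hp => hxw ?_⟩
      rw [if_neg hp] at h₁ h₂
      refine hJ.bij.injOn hx hw (hbw ▸ eq_pair_of_mem (hJ.card_label hx) hqr ?_ ?_)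
      · by_contra hq
        simp [hq] at h₁
      · by_contra hr
        simp [hr] at h₂
  · rintro ⟨hx, hp⟩
    by_cases hxv : x = v
    · exact Or.inl (Or.inl hxv)
    by_cases hxy : x = y
    · exact Or.inl (Or.inr hxy)
    have hq : q ∉ b x := fun hq => hxv (hJ.bij.injOn hx hv
      ((eq_pair_of_mem (hJ.card_label hx) hpq hp hq).trans hbv.symm))
    have hr : r ∉ b x := fun hr => hxy (hJ.bij.injOn hx hy
      ((eq_pair_of_mem (hJ.card_label hx) hpr hp hr).trans hby.symm))
    refine Or.inr ⟨?_, ⟨hx, by simp [hp, hq]⟩, hx, by simp [hp, hr]⟩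
    rintro rfl
    exact hq (by simp [hbw])

variable [Fintype V]

theorem fragments_IR_eq (hJ : ExhibitsJohnson F σ n b)
    (hT : IsTinhofer (modelGraph F) (modelColoring F)) (hn : 8 ≤ n) {v : Lit V} (hv : v ∈ σ) :
    fragments F σ (IR (modelGraph F) (baseColoring F) (Sum.inl v)) =
      {{v}, meeting σ b v 1, meeting σ b v 0} := by
  have hfrag : ∀ x ∈ σ, (σ.filter fun y =>
      IR (modelGraph F) (baseColoring F) (Sum.inl v) (Sum.inl y) =
        IR (modelGraph F) (baseColoring F) (Sum.inl v) (Sum.inl x)) =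
      meeting σ b v (b v ∩ b x).card := by
    intro x hx
    refine Finset.filter_congr fun y hy => ?_
    rw [hT.IR_baseColoring_eq_iff,
      ← exists_image_eq_iff (hJ.bij.mapsTo hv) (hJ.bij.mapsTo hy) (hJ.bij.mapsTo hx)]
    -- The stabilizer of one literal is the two-literal case with `v` repeated.
    simpa using hJ.exists_stabilizer_iff hv hv hy hx
  have hlt := hJ.card_meeting_one_lt hn hv
  have hpos : 0 < (meeting σ b v 1).card := by
    rw [hJ.card_meeting_one (by omega) hv]
    omega
  have hmem : ∀ c, (meeting σ b v c).Nonempty → meeting σ b v c ∈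
      fragments F σ (IR (modelGraph F) (baseColoring F) (Sum.inl v)) := by
    rintro c ⟨x, hx⟩
    rw [mem_meeting] at hx
    exact Finset.mem_image.2 ⟨x, hx.1, by rw [hfrag x hx.1, hx.2]⟩
  refine Finset.Subset.antisymm (fun S hS => ?_) (fun S hS => ?_)
  · obtain ⟨x, hx, rfl⟩ := Finset.mem_image.1 hS
    rw [hfrag x hx, ← hJ.meeting_two hv]
    have := hJ.card_inter_lt hv x
    generalize (b v ∩ b x).card = c at this
    interval_cases c <;> simp
  · simp only [Finset.mem_insert, Finset.mem_singleton] at hS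
    rcases hS with rfl | rfl | rfl
    · rw [← hJ.meeting_two hv]
      refine hmem 2 ?_
      rw [hJ.meeting_two hv]
      exact Finset.singleton_nonempty v
    · exact hmem 1 (Finset.card_pos.1 hpos)
    · exact hmem 0 (Finset.card_pos.1 (by omega))

/-- No tie between fragments can arise, so the outcome does not depend on the choice rule. -/
theorem explore_eq (hJ : ExhibitsJohnson F σ n b)
    (hT : IsTinhofer (modelGraph F) (modelColoring F)) (hn : 8 ≤ n) {v : Lit V} (hv : v ∈ σ)
    (ch : Choices V) (s : State V) (ad : Lit V → Finset (Lit V)) :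
    explore ch F σ s ad v = some (Function.update ad v (ad v ∪ meeting σ b v 1)) := by
  have hlt := hJ.card_meeting_one_lt hn hv
  have hone : 1 < (meeting σ b v 1).card := by
    rw [hJ.card_meeting_one (by omega) hv]
    omega
  have hQ := hJ.fragments_IR_eq hT hn hv
  have hsmall : smallerFragments
      (fragments F σ (IR (modelGraph F) (baseColoring F) (Sum.inl v))) = {meeting σ b v 1} := by
    rw [hQ]
    ext S
    simp only [smallerFragments, Finset.mem_filter, Finset.mem_insert, Finset.mem_singleton,
      forall_eq_or_imp, forall_eq, Finset.card_singleton]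
    constructor
    · rintro ⟨rfl | rfl | rfl, h₁, -, h₂, -⟩
      · simp at h₁
      · rfl
      · exact absurd (h₂ hone) (by omega)
    · rintro rfl
      exact ⟨Or.inr (Or.inl rfl), hone, fun h => absurd h (lt_irrefl 1), fun _ => le_rfl,
        fun _ => hlt.le⟩
  have hcard : (fragments F σ (IR (modelGraph F) (baseColoring F) (Sum.inl v))).card = 3 := by
    rw [hQ]
    refine Finset.card_eq_three.2 ⟨_, _, _, fun h => ?_, fun h => ?_, fun h => ?_, rfl⟩
    · have := congrArg Finset.card h
      rw [Finset.card_singleton] at this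
      omega
    · have := congrArg Finset.card h
      rw [Finset.card_singleton] at this
      omega
    · exact hlt.ne (congrArg Finset.card h)
  have hne : (smallerFragments
      (fragments F σ (IR (modelGraph F) (baseColoring F) (Sum.inl v)))).Nonempty := by
    rw [hsmall]
    exact Finset.singleton_nonempty _
  simp only [explore]
  rw [if_pos hcard, dif_pos hne]
  rw [Finset.mem_singleton.1 (hsmall.le (ch.fragment s v _ hne).2)]

/-- A permutation preserving `{i, j}` and `{i, k}` preserves their symmetric difference `{j, k}`.
Any further pair contains a point outside `{i, j, k}`, which can be moved with `i`, `j`, `k` fixed.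
-/
theorem thirdSingletons_eq (hJ : ExhibitsJohnson F σ n b)
    (hT : IsTinhofer (modelGraph F) (modelColoring F)) (hn : 8 ≤ n) {v w y : Lit V}
    (hv : v ∈ σ) (hw : w ∈ σ) (hy : y ∈ σ) {i j k : ℕ} (hij : i ≠ j) (hik : i ≠ k) (hjk : j ≠ k)
    (hbv : b v = {i, j}) (hbw : b w = {i, k}) (hby : b y = {j, k}) :
    thirdSingletons F σ v w = {y} := by
  have hcol : ∀ x ∈ σ, ∀ z ∈ σ, _ := fun x hx z hz =>
    (hT.IR_IR_baseColoring_eq_iff v w x z).trans (hJ.exists_stabilizer_iff hv hw hx hz)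
  have hsymm : symmDiff (b v) (b w) = b y := by
    rw [hbv, hbw, hby]
    ext t
    simp only [Finset.mem_symmDiff, Finset.mem_insert, Finset.mem_singleton]
    grind
  ext x
  simp only [thirdSingletons, Finset.mem_filter, Finset.mem_singleton]
  constructor
  · rintro ⟨hx, hxv, hxw, hfrag⟩
    by_contra hxy
    -- A singleton fragment is a one-element orbit of the stabilizer of both pairs.
    have huniq : ∀ z ∈ σ, (∃ τ ∈ symGroup n, (b v).image τ = b v ∧ (b w).image τ = b w ∧
        (b x).image τ = b z) → z = x := by
      intro z hz hzx
      obtain ⟨x', hx', he⟩ := Finset.mem_image.1 hfrag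
      have h₁ := Finset.mem_singleton.1 (he ▸ Finset.mem_filter.2 ⟨hx', rfl⟩ : x' ∈ ({x} : Finset _))
      subst h₁
      have h₂ : z ∈ ({x'} : Finset (Lit V)) :=
        he ▸ Finset.mem_filter.2 ⟨hz, ((hcol x' hx z hz).2 hzx).symm⟩
      exact Finset.mem_singleton.1 h₂
    have hns : ¬ b x ⊆ ({i, j, k} : Finset ℕ) := by
      intro hsub
      have hbx := hJ.card_label hx
      obtain ⟨p, q, hpq, he⟩ := Finset.card_eq_two.1 hbx
      have h₁ : b x ≠ {i, j} := fun h => hxv (hJ.bij.injOn hx hv (h.trans hbv.symm))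
      have h₂ : b x ≠ {i, k} := fun h => hxw (hJ.bij.injOn hx hw (h.trans hbw.symm))
      have h₃ : b x ≠ {j, k} := fun h => hxy (hJ.bij.injOn hx hy (h.trans hby.symm))
      rw [he] at hsub h₁ h₂ h₃
      simp only [Finset.insert_subset_iff, Finset.singleton_subset_iff, Finset.mem_insert,
        Finset.mem_singleton] at hsub
      obtain ⟨rfl | rfl | rfl, rfl | rfl | rfl⟩ := hsub <;>
        first
        | exact hpq rfl
        | exact h₁ rfl
        | exact h₂ rfl
        | exact h₃ rfl
        | exact h₁ (Finset.pair_comm _ _)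
        | exact h₂ (Finset.pair_comm _ _)
        | exact h₃ (Finset.pair_comm _ _)
    obtain ⟨τ, hτ, hfix, hne⟩ := exists_mem_symGroup_image_ne (hJ.label_subset hx) hns (by
      have h₁ := Finset.card_union_le ({i, j, k} : Finset ℕ) (b x)
      have h₂ := Finset.card_le_three (a := i) (b := j) (c := k)
      have h₃ := hJ.card_label hx
      omega : _ < n)
    simp only [Finset.mem_insert, Finset.mem_singleton, forall_eq_or_imp, forall_eq] at hfix
    obtain ⟨z, hz, hbz⟩ := hJ.bij.surjOn (image_mem_twoSubsets hτ (hJ.bij.mapsTo hx))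
    have hzx := huniq z hz ⟨τ, hτ, by simp [hbv, hfix], by simp [hbw, hfix], hbz.symm⟩
    exact hne (by rw [← hbz, hzx])
  · rintro rfl
    refine ⟨hy, ?_, ?_, ?_⟩
    · rintro rfl
      have : k ∈ b x := by simp [hby]
      simp only [hbv, Finset.mem_insert, Finset.mem_singleton] at this
      grind
    · rintro rfl
      have : j ∈ b x := by simp [hby]
      simp only [hbw, Finset.mem_insert, Finset.mem_singleton] at this
      grind
    · refine Finset.mem_image.2 ⟨x, hy, ?_⟩
      ext z
      rw [Finset.mem_filter, Finset.mem_singleton]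
      constructor
      · rintro ⟨hz, he⟩
        obtain ⟨τ, -, h₁, h₂, h₃⟩ := (hcol x hy z hz).1 he.symm
        refine hJ.bij.injOn hz hy ?_
        rw [← h₃, ← hsymm, Finset.image_symmDiff _ _ τ.injective, h₁, h₂]
      · rintro rfl
        exact ⟨hy, rfl⟩

end ExhibitsJohnson

end Fragments

/-! ### The main loop -/

section Loop

variable {V : Type u} {F : Formula V} {σ : Finset (Lit V)} {b : Lit V → Finset ℕ} {n : ℕ}

/-- The loop invariant for the labels: the points in `D` have been named `1, …, vnr - 1` by `f`, and
`label[x]` lists the names of the points in `D` that belong to the label of `x`. -/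
structure LabelInvariant (σ : Finset (Lit V)) (b : Lit V → Finset ℕ) (n : ℕ) (s : State V)
    (D : Finset ℕ) (f : ℕ → ℕ) : Prop where
  subset : D ⊆ Finset.Icc 1 n
  vnr_eq : s.vnr = D.card + 1
  injOn : Set.InjOn f D
  mapsTo : ∀ p ∈ D, f p ∈ Finset.Icc 1 D.card
  nodup : ∀ x ∈ σ, (s.label x).Nodup
  toFinset_label : ∀ x ∈ σ, (s.label x).toFinset = (b x ∩ D).image f

theorem mark_ad (s : State V) (E : Finset (Lit V)) : (mark s E).ad = s.ad := by
  unfold mark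
  split_ifs <;> rfl

/-- The pairs `{p, q}` and `{p, r}` share only `p`, and names are injective, so a name common to the
whole star of `p` can only be that of `p`. Hence the test in `mark` recognizes points already named.
-/
theorem ExhibitsJohnson.exists_common_label_iff (hJ : ExhibitsJohnson F σ n b) (hn : 3 ≤ n)
    {s : State V} {D : Finset ℕ} {f : ℕ → ℕ} (hs : LabelInvariant σ b n s D f) {p : ℕ}
    (hp : p ∈ Finset.Icc 1 n) : (∃ k, ∀ x ∈ star σ b p, k ∈ s.label x) ↔ p ∈ D := by
  have hlabel : ∀ x ∈ σ, ∀ k, k ∈ s.label x ↔ ∃ q, (q ∈ b x ∧ q ∈ D) ∧ f q = k := by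
    intro x hx k
    rw [← List.mem_toFinset, hs.toFinset_label x hx, Finset.mem_image]
    simp only [Finset.mem_inter]
  constructor
  · rintro ⟨k, hk⟩
    obtain ⟨q, hq, hqp⟩ : ∃ q ∈ Finset.Icc 1 n, q ∉ ({p} : Finset ℕ) :=
      Finset.exists_mem_notMem_of_card_lt_card (by simp; omega)
    obtain ⟨r, hr, hrpq⟩ : ∃ r ∈ Finset.Icc 1 n, r ∉ ({p, q} : Finset ℕ) :=
      Finset.exists_mem_notMem_of_card_lt_card (by
        have := Finset.card_le_two (a := p) (b := q)
        simp
        omega)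
    simp only [Finset.mem_insert, Finset.mem_singleton, not_or] at hqp hrpq
    obtain ⟨x, hx, hbx⟩ := hJ.exists_label_eq (Ne.symm hqp) hp hq
    obtain ⟨y, hy, hby⟩ := hJ.exists_label_eq (Ne.symm hrpq.1) hp hr
    obtain ⟨t, ⟨ht, htD⟩, hft⟩ :=
      (hlabel x hx k).1 (hk x (mem_star.2 ⟨hx, by simp [hbx]⟩))
    obtain ⟨t', ⟨ht', htD'⟩, hft'⟩ :=
      (hlabel y hy k).1 (hk y (mem_star.2 ⟨hy, by simp [hby]⟩))
    obtain rfl : t = t' := hs.injOn htD htD' (hft.trans hft'.symm)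
    simp only [hbx, hby, Finset.mem_insert, Finset.mem_singleton] at ht ht'
    rcases ht with rfl | rfl
    · exact htD
    · rcases ht' with rfl | rfl
      · exact htD
      · exact absurd rfl hrpq.2
  · intro hpD
    refine ⟨f p, fun x hx => ?_⟩
    rw [mem_star] at hx
    exact (hlabel x hx.1 _).2 ⟨p, ⟨hx.2, hpD⟩, rfl⟩

theorem LabelInvariant.mark_star {s : State V} {D : Finset ℕ} {f : ℕ → ℕ}
    (hs : LabelInvariant σ b n s D f) (hJ : ExhibitsJohnson F σ n b) (hn : 3 ≤ n) {p : ℕ}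
    (hp : p ∈ Finset.Icc 1 n) :
    ∃ f', LabelInvariant σ b n (mark s (star σ b p)) (insert p D) f' := by
  have hiff := hJ.exists_common_label_iff hn hs hp
  by_cases hpD : p ∈ D
  · refine ⟨f, ?_⟩
    rwa [mark, if_pos (hiff.2 hpD), Finset.insert_eq_of_mem hpD]
  -- The new point gets the name `vnr = D.card + 1`, which exceeds all names in use.
  · refine ⟨Function.update f p s.vnr, ?_⟩
    rw [mark, if_neg (hiff.not.2 hpD)]
    have hupd : ∀ q ∈ D, Function.update f p s.vnr q = f q := fun q hq =>
      Function.update_of_ne (ne_of_mem_of_not_mem hq hpD) _ _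
    have hlt : ∀ q ∈ D, f q < s.vnr := fun q hq => by
      have := (Finset.mem_Icc.1 (hs.mapsTo q hq)).2
      rw [hs.vnr_eq]
      omega
    have hcard := Finset.card_insert_of_notMem hpD
    have himage : ∀ x, (b x ∩ D).image (Function.update f p s.vnr) = (b x ∩ D).image f :=
      fun x => Finset.image_congr fun q hq => hupd q (Finset.mem_inter.1 hq).2
    have hnew : ∀ x ∈ σ, s.vnr ∉ s.label x := by
      intro x hx h
      rw [← List.mem_toFinset, hs.toFinset_label x hx, Finset.mem_image] at h
      obtain ⟨q, hq, he⟩ := h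
      exact (hlt q (Finset.mem_inter.1 hq).2).ne he
    refine ⟨Finset.insert_subset hp hs.subset, ?_, ?_, ?_, ?_, ?_⟩
    · rw [hcard, hs.vnr_eq]
    · rw [Finset.coe_insert, Set.injOn_insert (by exact_mod_cast hpD)]
      refine ⟨hs.injOn.congr fun q hq => (hupd q hq).symm, ?_⟩
      rintro ⟨q, hq, he⟩
      rw [hupd q hq, Function.update_self] at he
      exact (hlt q hq).ne he
    · intro q hq
      rw [hcard, Finset.mem_Icc]
      rcases Finset.mem_insert.1 hq with rfl | hq
      · rw [Function.update_self, hs.vnr_eq]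
        omega
      · rw [hupd q hq]
        have := Finset.mem_Icc.1 (hs.mapsTo q hq)
        omega
    · intro x hx
      dsimp only
      split_ifs with h
      · rw [List.nodup_append]
        refine ⟨hs.nodup x hx, List.nodup_singleton _, fun a ha c hc => ?_⟩
        rw [List.mem_singleton.1 hc]
        rintro rfl
        exact hnew x hx ha
      · exact hs.nodup x hx
    · intro x hx
      dsimp only
      split_ifs with h
      · rw [List.toFinset_append, hs.toFinset_label x hx,
          Finset.inter_insert_of_mem (mem_star.1 h).2, Finset.image_insert, himage,
          Function.update_self, Finset.union_comm]
        rfl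
      · rw [Finset.inter_insert_of_notMem fun h' => h (mem_star.2 ⟨hx, h'⟩), himage,
          hs.toFinset_label x hx]

/-- If all points are named, then the names form a permutation of `[n]`. -/
theorem LabelInvariant.exists_perm {s : State V} {f : ℕ → ℕ}
    (hs : LabelInvariant σ b n s (Finset.Icc 1 n) f) (hb : ∀ x ∈ σ, b x ⊆ Finset.Icc 1 n) :
    ∃ τ ∈ symGroup n, ∀ x ∈ σ, labelSet s.label x = (b x).image τ := by
  have hmaps : ∀ p ∈ Finset.Icc 1 n, f p ∈ Finset.Icc 1 n := fun p hp => by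
    simpa using hs.mapsTo p hp
  -- The tuple `i ↦ i + 1` on `Fin n` enumerates `[n]`, so `τ` agrees with `f` on all of `[n]`.
  obtain ⟨τ, hτ, hτf⟩ := exists_mem_symGroup_apply_eq (n := n) (k := n)
    (f := fun i => i.1 + 1) (g := fun i => f (i.1 + 1))
    (fun i j h => Fin.ext (by simpa using h))
    (fun i j h => Fin.ext (by
      have := hs.injOn (by simp) (by simp) h
      omega))
    (fun i => by simp) (fun i => hmaps _ (by simp))
  refine ⟨τ, hτ, fun x hx => ?_⟩
  have h := hs.toFinset_label x hx
  rw [Finset.inter_eq_left.2 (hb x hx)] at h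
  refine h.trans (Finset.image_congr fun p hp => ?_)
  have hp' := Finset.mem_Icc.1 (hb x hx hp)
  have := hτf ⟨p - 1, by omega⟩
  simp only [Nat.sub_add_cancel hp'.1] at this
  exact this.symm

variable [Fintype V]

/-- An iteration of the loop marks the stars of three points. -/
theorem ExhibitsJohnson.exists_iteration_eq (hJ : ExhibitsJohnson F σ n b)
    (hT : IsTinhofer (modelGraph F) (modelColoring F)) (hn : 8 ≤ n) (ch : Choices V)
    {s : State V} (had : ∀ x ∈ σ, s.ad x ⊆ meeting σ b x 1) {v : Lit V} (hv : v ∈ σ) :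
    ∃ i ∈ Finset.Icc 1 n, ∃ j ∈ Finset.Icc 1 n, ∃ k ∈ Finset.Icc 1 n, b v = {i, j} ∧
      ∃ ad : Lit V → Finset (Lit V), (∀ x ∈ σ, ad x ⊆ meeting σ b x 1) ∧
        iteration ch F σ s v =
          if (mark (mark (mark { s with ad := ad } (star σ b j)) (star σ b i))
            (star σ b k)).vnr = s.vnr then none
          else some (mark (mark (mark { s with ad := ad } (star σ b j)) (star σ b i))
            (star σ b k)) := by
  -- A literal may be explored repeatedly; since `ad` never holds anything but true neighbors, each
  -- exploration leaves exactly the neighborhood.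
  have hunion : ∀ (ad : Lit V → Finset (Lit V)), (∀ x ∈ σ, ad x ⊆ meeting σ b x 1) → ∀ z ∈ σ,
      Function.update ad z (ad z ∪ meeting σ b z 1) = Function.update ad z (meeting σ b z 1) :=
    fun ad h z hz => by rw [Finset.union_eq_right.2 (h z hz)]
  have hupd : ∀ (ad : Lit V → Finset (Lit V)), (∀ x ∈ σ, ad x ⊆ meeting σ b x 1) → ∀ z ∈ σ,
      ∀ x ∈ σ, Function.update ad z (meeting σ b z 1) x ⊆ meeting σ b x 1 := by
    intro ad h z hz x hx
    rcases eq_or_ne x z with rfl | hne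
    · rw [Function.update_self]
    · rw [Function.update_of_ne hne]
      exact h x hx
  set ad₁ := Function.update s.ad v (meeting σ b v 1) with had₁
  have hw : (ad₁ v).Nonempty := by
    rw [had₁, Function.update_self]
    refine Finset.card_pos.1 ?_
    rw [hJ.card_meeting_one (by omega) hv]
    omega
  obtain ⟨w, hwdef⟩ : ∃ w, w = (ch.neighbor s (ad₁ v) hw).1 := ⟨_, rfl⟩
  have hwmem : w ∈ meeting σ b v 1 := by
    have := (ch.neighbor s (ad₁ v) hw).2
    rwa [← hwdef, had₁, Function.update_self] at this
  obtain ⟨hwσ, hcard⟩ := mem_meeting.1 hwmem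
  obtain ⟨i, j, k, hij, hik, hjk, hbv, hbw⟩ :=
    exists_of_card_inter_eq_one (hJ.card_label hv) (hJ.card_label hwσ) hcard
  have hi : i ∈ Finset.Icc 1 n := hJ.label_subset hv (by simp [hbv])
  have hj : j ∈ Finset.Icc 1 n := hJ.label_subset hv (by simp [hbv])
  have hk : k ∈ Finset.Icc 1 n := hJ.label_subset hwσ (by simp [hbw])
  obtain ⟨y, hyσ, hby⟩ := hJ.exists_label_eq hjk hj hk
  have hthird := hJ.thirdSingletons_eq hT hn hv hwσ hyσ hij hik hjk hbv hbw hby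
  have hy : ∃ y, thirdSingletons F σ v w = {y} := ⟨y, hthird⟩
  have hychoose : hy.choose = y :=
    (Finset.singleton_injective (hthird.symm.trans hy.choose_spec)).symm
  have hne : ∀ {x z : Lit V} {t : ℕ}, t ∈ b x → t ∉ b z → x ≠ z := fun h h' he => h' (he ▸ h)
  have hvw : v ≠ w := hne (t := j) (by simp [hbv]) (by simp [hbw, hij.symm, hjk])
  have hvy : v ≠ y := hne (t := i) (by simp [hbv]) (by simp [hby, hij, hik])
  have hwy : w ≠ y := hne (t := i) (by simp [hbw]) (by simp [hby, hij, hik])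
  set ad₂ := Function.update ad₁ w (meeting σ b w 1) with had₂
  set ad := Function.update ad₂ y (meeting σ b y 1) with hadd
  have had₁' : ∀ x ∈ σ, ad₁ x ⊆ meeting σ b x 1 := hupd _ had v hv
  have had₂' : ∀ x ∈ σ, ad₂ x ⊆ meeting σ b x 1 := hupd _ had₁' w hwσ
  have hadv : ad v = meeting σ b v 1 := by
    rw [hadd, Function.update_of_ne hvy, had₂, Function.update_of_ne hvw, had₁,
      Function.update_self]
  have hadw : ad w = meeting σ b w 1 := by
    rw [hadd, Function.update_of_ne hwy, had₂, Function.update_self]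
  have hady : ad y = meeting σ b y 1 := by rw [hadd, Function.update_self]
  refine ⟨i, hi, j, hj, k, hk, hbv, ad, hupd _ had₂' y hyσ, ?_⟩
  have e₁ : explore ch F σ s s.ad v = some ad₁ := by
    rw [hJ.explore_eq hT hn hv, hunion _ had v hv]
  have e₂ : explore ch F σ s ad₁ w = some ad₂ := by
    rw [hJ.explore_eq hT hn hwσ, hunion _ had₁' w hwσ]
  have e₃ : explore ch F σ s ad₂ y = some ad := by
    rw [hJ.explore_eq hT hn hyσ, hunion _ had₂' y hyσ]
  -- The labels of `v`, `w`, `y` are `{i, j}`, `{i, k}`, `{j, k}`; each set is the star of the point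
  -- shared by its two named literals.
  have hEi : {v, y} ∪ (ad v ∩ ad y).erase w = star σ b j := by
    rw [hadv, hady]
    exact hJ.pair_union_eq_star hv hwσ hyσ hij.symm hjk hik (by rw [hbv, Finset.pair_comm]) hby hbw
  have hEj : {v, w} ∪ (ad v ∩ ad w).erase y = star σ b i := by
    rw [hadv, hadw]
    exact hJ.pair_union_eq_star hv hyσ hwσ hij hik hjk hbv hbw hby
  have hEk : {w, y} ∪ (ad w ∩ ad y).erase v = star σ b k := by
    rw [hadw, hady]
    exact hJ.pair_union_eq_star hwσ hv hyσ hik.symm hjk.symm hij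
      (by rw [hbw, Finset.pair_comm]) (by rw [hby, Finset.pair_comm]) hbv
  unfold iteration
  simp only [e₁, Option.bind_eq_bind, Option.bind_some]
  rw [dif_pos hw]
  simp only [← hwdef, e₂, Option.bind_some]
  rw [dif_pos hy]
  simp only [hychoose, e₃, Option.bind_some, hEi, hEj, hEk]

/-- The loop terminates with all points named. -/
theorem ExhibitsJohnson.exists_mem_mainLoop (hJ : ExhibitsJohnson F σ n b)
    (hT : IsTinhofer (modelGraph F) (modelColoring F)) (hn : 8 ≤ n) (ch : Choices V)
    (s : State V) (D : Finset ℕ) (f : ℕ → ℕ) (had : ∀ x ∈ σ, s.ad x ⊆ meeting σ b x 1)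
    (hs : LabelInvariant σ b n s D f) :
    ∃ s' f', some s' ∈ mainLoop ch F σ s ∧
      LabelInvariant σ b n s' (Finset.Icc 1 n) f' := by
  -- The measure is the number of points still unnamed.
  induction hm : n - D.card using Nat.strong_induction_on generalizing s D f with
  | _ m ih =>
  have hlen : ∀ x ∈ σ, (s.label x).length = (b x ∩ D).card := by
    intro x hx
    rw [← List.toFinset_card_of_nodup (hs.nodup x hx), hs.toFinset_label x hx]
    exact Finset.card_image_of_injOn (hs.injOn.mono (Finset.coe_subset.2 Finset.inter_subset_right))
  by_cases h : (unfinished σ s).Nonempty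
  · obtain ⟨v, hvdef⟩ : ∃ v, v = (ch.vertex s _ h).1 := ⟨_, rfl⟩
    have hvmem : v ∈ unfinished σ s := hvdef ▸ (ch.vertex s _ h).2
    obtain ⟨hv, hvlen⟩ := Finset.mem_filter.1 hvmem
    obtain ⟨i, hi, j, hj, k, hk, hbv, ad, had', hit⟩ := hJ.exists_iteration_eq hT hn ch had hv
    have hs₀ : LabelInvariant σ b n { s with ad := ad } D f :=
      ⟨hs.subset, hs.vnr_eq, hs.injOn, hs.mapsTo, hs.nodup, hs.toFinset_label⟩
    obtain ⟨f₁, hs₁⟩ := hs₀.mark_star hJ (by omega) hj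
    obtain ⟨f₂, hs₂⟩ := hs₁.mark_star hJ (by omega) hi
    obtain ⟨f₃, hs₃⟩ := hs₂.mark_star hJ (by omega) hk
    -- The chosen `v` has at most one label, so `i` or `j` was unnamed. The growth of `D` also makes
    -- `vnr` grow, so the check for a new label passes.
    have hlt : D.card < (insert k (insert i (insert j D))).card := by
      refine Finset.card_lt_card (Finset.ssubset_iff_subset_ne.2 ⟨fun t ht => by simp [ht], ?_⟩)
      intro he
      have hsub : b v ⊆ D := by
        rw [hbv, he]
        intro t ht
        simp only [Finset.mem_insert, Finset.mem_singleton] at ht ⊢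
        tauto
      rw [hlen v hv, Finset.inter_eq_left.2 hsub, hJ.card_label hv] at hvlen
      omega
    have hle : (insert k (insert i (insert j D))).card ≤ n := by
      simpa using Finset.card_le_card hs₃.subset
    rw [if_neg (by rw [hs₃.vnr_eq, hs.vnr_eq]; omega)] at hit
    obtain ⟨s', f', hs', hinv⟩ := ih _ (by omega) _ _ f₃
      (by simpa only [mark_ad] using had') hs₃ rfl
    refine ⟨s', f', ?_, hinv⟩
    refine PFun.mem_fix_iff.2 (Or.inr ⟨_, ?_, hs'⟩)
    rw [Part.mem_some_iff, loopStep, dif_pos h, ← hvdef, hit]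
  -- At exit every literal carries two labels, so both points of its pair are named, and every point
  -- lies in some pair.
  · have hD : D = Finset.Icc 1 n := by
      refine Finset.Subset.antisymm hs.subset fun p hp => ?_
      obtain ⟨q, hq, hqp⟩ : ∃ q ∈ Finset.Icc 1 n, q ∉ ({p} : Finset ℕ) :=
        Finset.exists_mem_notMem_of_card_lt_card (by simp; omega)
      rw [Finset.mem_singleton] at hqp
      obtain ⟨x, hx, hbx⟩ := hJ.exists_label_eq (Ne.symm hqp) hp hq
      have hx' : ¬ (s.label x).length ≤ 1 := fun h' =>
        h ⟨x, Finset.mem_filter.2 ⟨hx, h'⟩⟩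
      rw [hlen x hx] at hx'
      have := Finset.eq_of_subset_of_card_le (Finset.inter_subset_left (s₁ := b x) (s₂ := D))
        (by rw [hJ.card_label hx]; omega)
      exact Finset.inter_eq_left.1 this (by simp [hbx])
    refine ⟨s, f, PFun.mem_fix_iff.2 (Or.inl ?_), hD ▸ hs⟩
    rw [Part.mem_some_iff, loopStep, dif_neg h]

end Loop

/-! ### Recovering `n` from `|σ|`, and the two statements for the whole algorithm -/

/-- Identifies the `n` that the algorithm computes from `|σ|` with that of the Johnson group. The
bound excludes `0` and `1`, where the binomial coefficient vanishes twice. -/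
theorem choose_two_injective {m n : ℕ} (hn : 2 ≤ n) (h : m.choose 2 = n.choose 2) : m = n := by
  have hlt : ∀ {a c : ℕ}, 2 ≤ c → a < c → a.choose 2 < c.choose 2 := by
    intro a c hc hac
    obtain ⟨c, rfl⟩ := Nat.exists_eq_add_of_le' (by omega : 1 ≤ c)
    have h₁ : (c + 1).choose 2 = c.choose 1 + c.choose 2 := Nat.choose_succ_succ _ _
    have h₂ := Nat.choose_le_choose 2 (Nat.le_of_lt_succ hac)
    rw [Nat.choose_one_right] at h₁
    omega
  rcases lt_trichotomy m n with hmn | hmn | hmn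
  · exact absurd h (hlt hn hmn).ne
  · exact hmn
  · exact absurd h (hlt (by omega) hmn).ne'

theorem verified_of_mem_detectJohnson {V : Type u} [Fintype V] {ch : Choices V} {F : Formula V}
    {σ : Finset (Lit V)} {label : Lit V → List ℕ} (h : some label ∈ detectJohnson ch F σ) :
    ∃ n : ℕ, σ.card = n.choose 2 ∧ Verified F σ n label := by
  unfold detectJohnson at h
  split_ifs at h with hc
  · obtain ⟨r, -, hr⟩ := (Part.mem_map_iff _).1 h
    obtain ⟨s, -, hs⟩ := Option.bind_eq_some_iff.1 hr
    split_ifs at hs with hver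
    obtain rfl := Option.some.inj hs
    exact ⟨_, Nat.find_spec hc.2, hver⟩
  · simp at h

theorem ExhibitsJohnson.exists_mem_detectJohnson {V : Type u} [Fintype V] {F : Formula V}
    {σ : Finset (Lit V)} {n : ℕ} {b : Lit V → Finset ℕ} (hJ : ExhibitsJohnson F σ n b)
    (hT : IsTinhofer (modelGraph F) (modelColoring F)) (hn : 8 ≤ n) (ch : Choices V) :
    ∃ label : Lit V → List ℕ, some label ∈ detectJohnson ch F σ ∧
      ∃ τ ∈ symGroup n, ∀ l ∈ σ, labelSet label l = (b l).image τ := by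
  obtain ⟨s, f, hs, hinv⟩ := hJ.exists_mem_mainLoop hT hn ch
    { label := fun _ => [], ad := fun _ => ∅, vnr := 1 } ∅ id (by simp)
    ⟨by simp, by simp, by simp, by simp, by simp, by simp⟩
  obtain ⟨τ, hτ, hlabel⟩ := hinv.exists_perm fun x hx => hJ.label_subset hx
  -- The threshold `28` is `Nat.choose 8 2`.
  have hc : 28 ≤ σ.card ∧ ∃ n : ℕ, σ.card = n.choose 2 :=
    ⟨hJ.card_eq ▸ (by decide : 28 ≤ Nat.choose 8 2).trans (Nat.choose_le_choose 2 hn),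
      n, hJ.card_eq⟩
  have hfind : Nat.find hc.2 = n :=
    choose_two_injective (by omega) ((Nat.find_spec hc.2).symm.trans hJ.card_eq)
  have hver := hJ.verified (hJ.neg_notMem (by omega)) hτ hlabel
  refine ⟨s.label, ?_, τ, hτ, hlabel⟩
  unfold detectJohnson
  rw [dif_pos hc]
  refine (Part.mem_map_iff _).2 ⟨some s, hs, ?_⟩
  rw [Option.bind_some, if_pos (by rwa [hfind])]

end JohnsonSym

theorem mainTheorem3 {V : Type*} [Fintype V] (F : Formula V) (σ : Finset (Lit V))
    (ch : Choices V) :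
    -- (1) every returned labeling yields symmetries of `F`
    ((∀ l ∈ σ, neg l ∉ σ) →
      ∀ label : Lit V → List ℕ, some label ∈ detectJohnson ch F σ →
        ∃ n : ℕ, σ.card = n.choose 2 ∧
          Set.BijOn (labelSet label) (σ : Set (Lit V)) (twoSubsets n : Set (Finset ℕ)) ∧
          ∀ τ ∈ symGroup n, IsSymmetry F (expand (inducedPerm σ (labelSet label) τ))) ∧
    -- (2) Johnson symmetry is detected if the model graph is Tinhofer
    (∀ (n : ℕ) (b : Lit V → Finset ℕ), 8 ≤ n → ExhibitsJohnson F σ n b →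
      IsTinhofer (modelGraph F) (modelColoring F) →
        ∃ label : Lit V → List ℕ, some label ∈ detectJohnson ch F σ ∧
          ∃ τ ∈ symGroup n, ∀ l ∈ σ, labelSet label l = (b l).image τ) := by
  refine ⟨fun hσ label h => ?_, fun n b hn hJ hT => hJ.exists_mem_detectJohnson hT hn ch⟩
  obtain ⟨n, hcard, hbij, hsym⟩ := verified_of_mem_detectJohnson h
  exact ⟨n, hcard, hbij, fun τ hτ => isSymmetry_expand_of_adjacent_swaps hbij hσ hsym hτ⟩
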